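/- Let $\Gamma$ be a bipartite graph with $e=d\cdot m$ edges, where $d,m\ge 1$ are integers. A \emph{$d$-divisible graceful labeling} of $\Gamma$ is an injective function $f:V(\Gamma)\to\{0,1,\dots,d(m+1)-1\}$ such that $$\{|f(x)-f(y)| : [x,y]\in E(\Gamma)\}=\{1,2,\dots,d(m+1)-1\}\setminus\{m+1,2(m+1),\dots,(d-1)(m+1)\}.$$ It is a \emph{$d$-divisible $\alpha$-labeling} if, moreover, the maximum value of $f$ on one of the two bipartite sets of $\Gamma$ is smaller than its minimum value on the other one. For $t\ge 2$ and $\lambda\ge 1$ let $H(2t,\lambda)=C_{2t}\odot\lambda K_1$ be the corona (hairy cycle) obtained from the cycle of length $2t$ by attaching $\lambda$ pendant edges to each vertex of the cycle. \textbf{Theorem.} For all integers $t\ge 2$ and $\lambda\ge 1$, the graph $H(2t,\lambda)$ has exactly $2t(\lambda+1)$ edges, and for every divisor $d$ of $2t(\lambda+1)$ it admits a $d$-divisible $\alpha$-labeling. -/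

import Mathlib

/-- The corona `G ⊙ H`: take `G` together with one copy of `H` for every vertex `v` of `G`, and join
`v` to every vertex of its own copy. The vertex `(v, w)` is the vertex `w` of the copy attached
to `v`. -/
def SimpleGraph.corona {V W : Type*} (G : SimpleGraph V) (H : SimpleGraph W) :
    SimpleGraph (V ⊕ V × W) where
  Adj
    | .inl u, .inl v => G.Adj u v
    | .inl u, .inr q => u = q.1
    | .inr p, .inl v => p.1 = v
    | .inr p, .inr q => p.1 = q.1 ∧ H.Adj p.2 q.2
  symm := ⟨by
    rintro (u | p) (v | q) h
    · exact G.adj_symm h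
    · exact Eq.symm h
    · exact Eq.symm h
    · exact ⟨h.1.symm, H.adj_symm h.2⟩⟩
  loopless := ⟨by
    rintro (u | p) h
    · exact G.irrefl h
    · exact H.irrefl h.2⟩

/-- The hairy cycle `H(2t, l) = C_{2t} ⊙ l K₁`: the cycle of length `2t` with `l` pendant edges
attached to each of its vertices. -/
def hairyCycle (t l : ℕ) : SimpleGraph (Fin (2 * t) ⊕ Fin (2 * t) × Fin l) :=
  (SimpleGraph.cycleGraph (2 * t)).corona (⊥ : SimpleGraph (Fin l))

/-- `f` is a `d`-divisible graceful labeling of `G`, a graph of size `e = d * m`: an injective map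
to `{0, ..., d(m+1) - 1}` whose set of edge labels `|f x - f y|` is
`{1, ..., d(m+1) - 1}` without `m+1, 2(m+1), ..., (d-1)(m+1)`. -/
def SimpleGraph.IsDivisibleGracefulLabeling {V : Type*} (G : SimpleGraph V) (d : ℕ) (f : V → ℕ) :
    Prop :=
  0 < d ∧ G.edgeSet.Finite ∧ ∃ m : ℕ, G.edgeSet.ncard = d * m ∧
    Function.Injective f ∧ (∀ x, f x ∈ Set.Icc 0 (d * (m + 1) - 1)) ∧
    {n : ℕ | ∃ x y, G.Adj x y ∧ (n : ℤ) = |(f x : ℤ) - (f y : ℤ)|} =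
      Set.Icc 1 (d * (m + 1) - 1) \ {n : ℕ | ∃ j ∈ Set.Icc 1 (d - 1), n = j * (m + 1)}

/-- `f` is a `d`-divisible `α`-labeling of `G`: a `d`-divisible graceful labeling such that `G` is
bipartite with parts `A` and `B` for which the values of `f` on `A` are below those on `B`. -/
def SimpleGraph.IsDivisibleAlphaLabeling {V : Type*} (G : SimpleGraph V) (d : ℕ) (f : V → ℕ) :
    Prop :=
  G.IsDivisibleGracefulLabeling d f ∧
    ∃ A B : Set V, A ∪ B = Set.univ ∧ G.IsBipartiteWith A B ∧ ∀ a ∈ A, ∀ b ∈ B, f a < f b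

/-! Write $L=l+1$, $T=tL$, and list the admissible differences decreasingly as $w_0>\dots>w_{2T-1}$
(`admissibleDiff`). Walk along the cycle from label 0, alternately adding and subtracting the
differences of the cycle edges; a leaf at a vertex uses the sign of the cycle edge leaving that
vertex. If the positions in the list increase along the walk, the leaves of a vertex coming before
its outgoing cycle edge, the labels zigzag: even cycle vertices with leaves of odd ones climb from
below, odd cycle vertices with leaves of even ones descend from above. This gives injectivity and
the separation of the two parts (`IsZigzag`).

The closing edge remains: its difference must equal the label of the last cycle vertex. It receives
the middle position $T-1$, and the positions from there on shift by one. As $w_i+w_{2T-1-i}=d(m+1)$,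
pairing terms evaluates the last label (`two_mul_alternating_sum`): it is $w_{T-1}$, as needed, for
$t$ even, but $w_T$ for $t$ odd.

For $t$ odd the deficit $w_{T-1}-w_T$ is 1, or 2 if $m\mid T$. It is made up by moving the cycle
edge at $t-3$ one position earlier (`a = 1`), the one at $t$ one position later (`b = 1`), or both.
Each move throws one leaf out of the zigzag. With $2k_0=t-1$, its label exceeds that of cycle vertex
$2k_0$ by an amount strictly between $w_T$ and $w_{T-2}$, a gap left free because $w_{T-1}$ belongs
to the closing edge. The switch `c` keeps two such leaves apart. `exists_edgePos_parameters` chooses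
the switches. -/

/-! ### Edges and bipartition of the hairy cycle -/

/-- The labels of the cycle vertices when the cycle edge following the vertex `j` receives the
difference `w (Q j l)`. -/
def spineLabel (w : ℕ → ℤ) (Q : ℕ → ℕ → ℕ) (l : ℕ) : ℕ → ℤ
  | 0 => 0
  | j + 1 => spineLabel w Q l j + (-1) ^ j * w (Q j l)

/-- The label of the leaf `q` attached to the cycle vertex `j`, whose edge receives the difference
`w (Q j q)`. -/
def leafLabel (w : ℕ → ℤ) (Q : ℕ → ℕ → ℕ) (l j q : ℕ) : ℤ :=
  spineLabel w Q l j + (-1) ^ j * w (Q j q)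

/-- The labeling of the hairy cycle assembled from `spineLabel` and `leafLabel`. -/
def hairyLabel (w : ℕ → ℤ) (Q : ℕ → ℕ → ℕ) (t l : ℕ) :
    Fin (2 * t) ⊕ Fin (2 * t) × Fin l → ℤ
  | .inl j => spineLabel w Q l j
  | .inr p => leafLabel w Q l p.1 p.2

/-- The cyclic successor of a vertex of the cycle. -/
def cycleNext {t : ℕ} (j : Fin (2 * t)) : Fin (2 * t) :=
  ⟨(j + 1) % (2 * t), Nat.mod_lt _ (by have := j.2; omega)⟩

/-- The edges of the hairy cycle, indexed by the cycle vertices together with either a leaf or the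
cyclic successor. -/
def hairyEdge {t l : ℕ} : Fin (2 * t) × Option (Fin l) → Sym2 (Fin (2 * t) ⊕ Fin (2 * t) × Fin l)
  | (j, none) => s(.inl j, .inl (cycleNext j))
  | (j, some q) => s(.inl j, .inr (j, q))

theorem cycleNext_val {t : ℕ} (j : Fin (2 * t)) :
    (j.val + 1 < 2 * t ∧ (cycleNext j).val = j.val + 1) ∨
      (j.val + 1 = 2 * t ∧ (cycleNext j).val = 0) := by
  have := j.2
  rcases Nat.lt_or_ge (j.val + 1) (2 * t) with h | h
  · exact Or.inl ⟨h, Nat.mod_eq_of_lt h⟩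
  · have h' : j.val + 1 = 2 * t := by omega
    refine Or.inr ⟨h', ?_⟩
    simp [cycleNext, h']

theorem cycleGraph_adj_iff_cycleNext {t : ℕ} (u v : Fin (2 * t)) :
    (SimpleGraph.cycleGraph (2 * t)).Adj u v ↔ v = cycleNext u ∨ u = cycleNext v := by
  have key : ∀ a b : Fin (2 * t), (a - b).val = 1 ↔ a = cycleNext b := by
    intro a b
    have ha := a.2
    have hb := b.2
    rw [Fin.ext_iff, Fin.sub_def]
    rcases Nat.lt_or_ge a.val b.val with h | h
    · have : 2 * t - b.val + a.val < 2 * t := by omega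
      simp only [Nat.mod_eq_of_lt this]
      rcases cycleNext_val b with h' | h' <;> omega
    · have : 2 * t - b.val + a.val = (a.val - b.val) + 2 * t := by omega
      simp only [this, Nat.add_mod_right, Nat.mod_eq_of_lt (show a.val - b.val < 2 * t by omega)]
      rcases cycleNext_val b with h' | h' <;> omega
  rw [SimpleGraph.cycleGraph_adj', key, key, or_comm]

theorem hairyCycle_adj_iff {t l : ℕ} (ht : 2 ≤ t) (x y : Fin (2 * t) ⊕ Fin (2 * t) × Fin l) :
    (hairyCycle t l).Adj x y ↔ ∃ s, hairyEdge s = s(x, y) := by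
  rcases x with u | ⟨u, p⟩ <;> rcases y with v | ⟨v, q⟩
  · have h : (hairyCycle t l).Adj (.inl u) (.inl v) ↔
        (SimpleGraph.cycleGraph (2 * t)).Adj u v := Iff.rfl
    rw [h, cycleGraph_adj_iff_cycleNext]
    simp only [Prod.exists, Option.exists, hairyEdge, Sym2.eq_iff]
    aesop
  · have h : (hairyCycle t l).Adj (.inl u) (.inr (v, q)) ↔ u = v := Iff.rfl
    rw [h]
    simp only [Prod.exists, Option.exists, hairyEdge, Sym2.eq_iff]
    aesop
  · have h : (hairyCycle t l).Adj (.inr (u, p)) (.inl v) ↔ u = v := Iff.rfl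
    rw [h]
    simp only [Prod.exists, Option.exists, hairyEdge, Sym2.eq_iff]
    aesop
  · have h : (hairyCycle t l).Adj (.inr (u, p)) (.inr (v, q)) ↔ u = v ∧ False := Iff.rfl
    rw [h]
    simp only [Prod.exists, Option.exists, hairyEdge, Sym2.eq_iff]
    aesop

theorem hairyEdge_injective {t l : ℕ} (ht : 2 ≤ t) :
    Function.Injective (hairyEdge (t := t) (l := l)) := by
  rintro ⟨u, _ | p⟩ ⟨v, _ | q⟩ h
  · simp only [hairyEdge, Sym2.eq_iff, Sum.inl.injEq] at h
    rcases h with ⟨h, -⟩ | ⟨h, h'⟩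
    · rw [h]
    -- Two cycle edges agreeing with reversed ends would force a cycle of length 2.
    · exfalso
      rw [Fin.ext_iff] at h h'
      rcases cycleNext_val u with h1 | h1 <;> rcases cycleNext_val v with h2 | h2 <;> omega
  · simp [hairyEdge] at h
  · simp [hairyEdge] at h
  · simp only [hairyEdge, Sym2.eq_iff, Sum.inl.injEq, Sum.inr.injEq, Prod.mk.injEq] at h
    aesop

theorem hairyCycle_edgeSet {t l : ℕ} (ht : 2 ≤ t) :
    (hairyCycle t l).edgeSet = Set.range hairyEdge := by
  ext z
  induction z with
  | _ x y => rw [SimpleGraph.mem_edgeSet, hairyCycle_adj_iff ht, Set.mem_range]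

theorem hairyCycle_edgeSet_ncard {t l : ℕ} (ht : 2 ≤ t) :
    (hairyCycle t l).edgeSet.ncard = 2 * t * (l + 1) := by
  rw [hairyCycle_edgeSet ht, ← Set.image_univ,
    Set.ncard_image_of_injective _ (hairyEdge_injective ht), Set.ncard_univ]
  simp [Nat.card_eq_fintype_card]

/-- The vertices of the hairy cycle at even distance from the cycle vertex `0`. -/
def hairyEven (t l : ℕ) : Set (Fin (2 * t) ⊕ Fin (2 * t) × Fin l) :=
  {x | match x with
    | .inl j => Even j.val
    | .inr p => ¬ Even p.1.val}

theorem hairyCycle_isBipartiteWith {t l : ℕ} (ht : 2 ≤ t) :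
    (hairyCycle t l).IsBipartiteWith (hairyEven t l) (hairyEven t l)ᶜ := by
  refine ⟨disjoint_compl_right, ?_⟩
  have next : ∀ j : Fin (2 * t), Even (cycleNext j).val ↔ ¬ Even j.val := by
    intro j
    simp only [Nat.even_iff]
    rcases cycleNext_val j with h | h <;> omega
  intro x y h
  obtain ⟨⟨j, r⟩, hs⟩ := (hairyCycle_adj_iff ht x y).1 h
  rcases r with _ | q <;> simp only [hairyEdge, Sym2.eq_iff] at hs <;>
    rcases hs with ⟨rfl, rfl⟩ | ⟨rfl, rfl⟩ <;> by_cases hj : Even j.val <;>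
      simp [hairyEven, next, hj, -Nat.not_even_iff_odd]

/-! ### The admissible differences -/

/-- The `i`-th largest of the differences `1, ..., d (m + 1) - 1` that are not multiples of
`m + 1`. -/
def admissibleDiff (d m i : ℕ) : ℤ := d * (m + 1) - 1 - i - (i / m : ℕ)

theorem admissibleDiff_lt {d m i j : ℕ} (h : i < j) : admissibleDiff d m j < admissibleDiff d m i := by
  have := Nat.div_le_div_right (c := m) h.le
  unfold admissibleDiff
  omega

/-- The admissible set is invariant under $x\mapsto d(m+1)-x$, which reverses the list. In terms of
the formula, complementary indices have quotients by $m$ adding to $d-1$. -/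
theorem admissibleDiff_add_symm {d m i j : ℕ} (hm : 0 < m) (h : i + j + 1 = d * m) :
    admissibleDiff d m i + admissibleDiff d m j = d * (m + 1) := by
  have h1 : i / m + j / m + 1 = d := by
    have hi := Nat.div_add_mod i m
    have hj := Nat.div_add_mod j m
    have hi' := Nat.mod_lt i hm
    have hj' := Nat.mod_lt j hm
    have e : m * (i / m + j / m) + (i % m + j % m + 1) = d * m := by
      rw [mul_add]; omega
    have hlt : i / m + j / m < d := by
      by_contra hc
      have := Nat.mul_le_mul_left m (not_lt.1 hc)
      rw [mul_comm m d] at this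
      omega
    have hgt : d < i / m + j / m + 2 := by
      by_contra hc
      have := Nat.mul_le_mul_left m (not_lt.1 hc)
      rw [mul_comm m d, mul_add] at this
      omega
    omega
  have h2 : (d : ℤ) * (m + 1) = i + j + 1 + (i / m + j / m + 1 : ℕ) := by
    rw [h1, mul_add, mul_one]
    have : ((i + j + 1 : ℕ) : ℤ) = ((d * m : ℕ) : ℤ) := by rw [h]
    push_cast at this
    omega
  unfold admissibleDiff
  rw [h2]
  push_cast
  ring

theorem admissibleDiff_pos {d m i : ℕ} (hm : 0 < m) (h : i < d * m) :
    0 < admissibleDiff d m i := by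
  have h1 := admissibleDiff_add_symm (d := d) (m := m) (i := i) (j := d * m - 1 - i) hm (by omega)
  have h2 : admissibleDiff d m (d * m - 1 - i) < d * (m + 1) := by
    have h3 : (0 : ℤ) ≤ (((d * m - 1 - i) / m : ℕ) : ℤ) := Int.natCast_nonneg _
    have h4 : (0 : ℤ) ≤ ((d * m - 1 - i : ℕ) : ℤ) := Int.natCast_nonneg _
    unfold admissibleDiff
    linarith
  linarith

theorem admissibleDiff_range {d m : ℕ} (hd : 0 < d) (hm : 0 < m) :
    {n : ℕ | ∃ i < d * m, (n : ℤ) = admissibleDiff d m i} =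
      Set.Icc 1 (d * (m + 1) - 1) \ {n : ℕ | ∃ j ∈ Set.Icc 1 (d - 1), n = j * (m + 1)} := by
  have hpos : 0 < d * (m + 1) := by positivity
  ext n
  simp only [Set.mem_ofPred_eq, Set.mem_sdiff, Set.mem_Icc]
  constructor
  · rintro ⟨i, hi, hn⟩
    have h1 := admissibleDiff_pos hm hi
    have h2 : (n : ℤ) + 1 + i + (i / m : ℕ) = ((d * (m + 1) : ℕ) : ℤ) := by
      rw [hn]; unfold admissibleDiff; push_cast; ring
    have h3 : n + 1 + i + i / m = d * (m + 1) := by exact_mod_cast h2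
    have h4 : n + 1 ≤ d * (m + 1) := by linarith [Nat.zero_le (i / m), Nat.zero_le i]
    refine ⟨⟨by omega, by omega⟩, ?_⟩
    rintro ⟨k, -, rfl⟩
    have h4 : (m + 1) * (k + i / m) + (i % m + 1) = d * (m + 1) := by
      rw [← h3, mul_add, mul_comm (m + 1) k, add_mul, one_mul]
      have := Nat.div_add_mod i m
      omega
    -- Impossible, since `i % m + 1` lies between 1 and $m$.
    have h5 : (m + 1) ∣ i % m + 1 :=
      (Nat.dvd_add_right (Dvd.intro _ rfl)).1 (h4 ▸ Dvd.intro_left d rfl)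
    have := Nat.le_of_dvd (by omega) h5
    have := Nat.mod_lt i hm
    omega
  · rintro ⟨⟨h1, h2⟩, h3⟩
    -- Counting down from the top in blocks of $m+1$, the last entry of each block ($b=m$) is a
    -- forbidden multiple; deleting it turns block $a$, offset $b$ into index $ma+b$.
    set r := d * (m + 1) - 1 - n with hr
    set a := r / (m + 1) with ha
    set b := r % (m + 1) with hb
    have hab : (m + 1) * a + b = r := Nat.div_add_mod r (m + 1)
    have h4 : b < m + 1 := Nat.mod_lt _ (by omega)
    clear_value a b
    have hbm : b < m := by
      rcases Nat.lt_or_ge b m with h | h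
      · exact h
      exfalso
      have h5 : n + (m + 1) * (a + 1) = d * (m + 1) := by rw [mul_add]; omega
      have h6 : a + 1 < d := by
        by_contra hc
        have := Nat.mul_le_mul_left (m + 1) (not_lt.1 hc)
        rw [mul_comm (m + 1) d] at this
        omega
      refine h3 ⟨d - (a + 1), by omega, ?_⟩
      rw [Nat.sub_mul, mul_comm (a + 1)]
      omega
    have hdiv : (m * a + b) / m = a := by
      rw [Nat.mul_add_div hm, Nat.div_eq_of_lt hbm, add_zero]
    refine ⟨m * a + b, ?_, ?_⟩
    · have h4 : a < d := by
        by_contra hc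
        have := Nat.mul_le_mul_left (m + 1) (not_lt.1 hc)
        rw [mul_comm (m + 1) d] at this
        omega
      have := Nat.mul_le_mul_left m (show a + 1 ≤ d from h4)
      rw [mul_comm m d, mul_add] at this
      omega
    · unfold admissibleDiff
      rw [hdiv]
      have h4 : n + 1 + (m * a + b) + a = d * (m + 1) := by
        have : (m + 1) * a = m * a + a := by ring
        omega
      have h5 : ((n + 1 + (m * a + b) + a : ℕ) : ℤ) = ((d * (m + 1) : ℕ) : ℤ) := by rw [h4]
      push_cast at h5 ⊢
      linarith

/-! ### Reduction to conditions on the positions -/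

/-- True by construction for every edge except the one returning to vertex 0, whose label is 0;
`hclose` covers that one. -/
theorem abs_hairyLabel_sub {w : ℕ → ℤ} {Q : ℕ → ℕ → ℕ} {t l : ℕ}
    (hpos : ∀ j < 2 * t, ∀ r ≤ l, 0 < w (Q j r))
    (hclose : spineLabel w Q l (2 * t - 1) = w (Q (2 * t - 1) l))
    {x y : Fin (2 * t) ⊕ Fin (2 * t) × Fin l} {j : Fin (2 * t)} {r : Option (Fin l)}
    (h : hairyEdge (j, r) = s(x, y)) :
    |hairyLabel w Q t l x - hairyLabel w Q t l y| = w (Q j (r.elim l Fin.val)) := by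
  have key : ∀ a b : ℤ, ∀ n : ℕ, 0 < b → |a - (a + (-1) ^ n * b)| = b := by
    intro a b n hb
    rw [sub_add_cancel_left, abs_neg, abs_mul, abs_neg_one_pow, one_mul, abs_of_pos hb]
  have aux : ∀ u v, hairyEdge (j, r) = s(u, v) →
      |hairyLabel w Q t l x - hairyLabel w Q t l y| =
        |hairyLabel w Q t l u - hairyLabel w Q t l v| := by
    intro u v huv
    rw [h, Sym2.eq_iff] at huv
    rcases huv with ⟨rfl, rfl⟩ | ⟨rfl, rfl⟩
    · rfl
    · exact abs_sub_comm _ _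
  rcases r with _ | q
  · rw [aux _ _ rfl]
    simp only [hairyLabel, Option.elim]
    have hp := hpos j j.2 l le_rfl
    rcases cycleNext_val j with ⟨h1, h2⟩ | ⟨h1, h2⟩
    · rw [h2, spineLabel]
      exact key _ _ _ hp
    · have hj : j.val = 2 * t - 1 := by omega
      rw [h2, hj, spineLabel, hclose, sub_zero, abs_of_pos (hj ▸ hp)]
  · rw [aux _ _ rfl]
    simp only [hairyLabel, Option.elim, leafLabel]
    exact key _ _ _ (hpos j j.2 q q.2.le)

theorem isDivisibleAlphaLabeling_hairyLabel {d m t l : ℕ} {Q : ℕ → ℕ → ℕ} (ht : 2 ≤ t)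
    (hd : 0 < d) (hm : 0 < m) (he : 2 * t * (l + 1) = d * m)
    (hQlt : ∀ j < 2 * t, ∀ r ≤ l, Q j r < d * m)
    (hQsurj : ∀ i < d * m, ∃ j < 2 * t, ∃ r ≤ l, Q j r = i)
    (hclose : spineLabel (admissibleDiff d m) Q l (2 * t - 1) =
      admissibleDiff d m (Q (2 * t - 1) l))
    (hinj : Function.Injective (hairyLabel (admissibleDiff d m) Q t l))
    (hnonneg : ∀ x, 0 ≤ hairyLabel (admissibleDiff d m) Q t l x)
    (hle : ∀ x, hairyLabel (admissibleDiff d m) Q t l x ≤ d * (m + 1) - 1)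
    (hlt : ∀ a ∈ hairyEven t l, ∀ b ∉ hairyEven t l,
      hairyLabel (admissibleDiff d m) Q t l a < hairyLabel (admissibleDiff d m) Q t l b) :
    (hairyCycle t l).IsDivisibleAlphaLabeling d
      (fun x => (hairyLabel (admissibleDiff d m) Q t l x).toNat) := by
  have hf : ∀ x, ((hairyLabel (admissibleDiff d m) Q t l x).toNat : ℤ) =
      hairyLabel (admissibleDiff d m) Q t l x := fun x => Int.toNat_of_nonneg (hnonneg x)
  have habs := @abs_hairyLabel_sub (admissibleDiff d m) Q t l
    (fun j hj r hr => admissibleDiff_pos hm (hQlt j hj r hr)) hclose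
  have hpos : 0 < d * (m + 1) := by positivity
  refine ⟨⟨hd, ?_, m, ?_, ?_, ?_, ?_⟩, hairyEven t l, (hairyEven t l)ᶜ, Set.union_compl_self _,
    hairyCycle_isBipartiteWith ht, ?_⟩
  · exact Set.toFinite _
  · rw [hairyCycle_edgeSet_ncard ht, he]
  · intro x y hxy
    apply hinj
    rw [← hf x, ← hf y]
    exact congrArg Nat.cast hxy
  · intro x
    refine ⟨Nat.zero_le _, ?_⟩
    have h1 := hle x
    rw [← hf] at h1
    have h2 : ((d * (m + 1) : ℕ) : ℤ) = d * (m + 1) := by push_cast; ring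
    rw [← h2] at h1
    simp only
    omega
  · rw [← admissibleDiff_range hd hm]
    ext n
    simp only [Set.mem_ofPred_eq, hf]
    constructor
    · rintro ⟨x, y, hxy, hn⟩
      obtain ⟨⟨j, r⟩, hs⟩ := (hairyCycle_adj_iff ht x y).1 hxy
      rw [habs hs] at hn
      refine ⟨_, hQlt j j.2 _ ?_, hn⟩
      rcases r with _ | q
      · exact le_rfl
      · exact q.2.le
    · rintro ⟨i, hi, hn⟩
      obtain ⟨j, hj, r, hr, rfl⟩ := hQsurj i hi
      have hslot : ∃ r' : Option (Fin l), r'.elim l Fin.val = r := by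
        rcases hr.eq_or_lt with rfl | hr
        · exact ⟨none, rfl⟩
        · exact ⟨some ⟨r, hr⟩, rfl⟩
      obtain ⟨r', rfl⟩ := hslot
      obtain ⟨x, y, hxy⟩ : ∃ x y, hairyEdge ((⟨j, hj⟩ : Fin (2 * t)), r') = s(x, y) := by
        induction h : hairyEdge ((⟨j, hj⟩ : Fin (2 * t)), r') with
        | _ x y => exact ⟨x, y, rfl⟩
      exact ⟨x, y, (hairyCycle_adj_iff ht x y).2 ⟨_, hxy⟩, by rw [habs hxy, hn]⟩
  · intro a ha b hb
    have := hlt a ha b hb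
    rw [← hf a, ← hf b] at this
    exact_mod_cast this

theorem spineLabel_odd (w : ℕ → ℤ) (Q : ℕ → ℕ → ℕ) (l k : ℕ) :
    spineLabel w Q l (2 * k + 1) = spineLabel w Q l (2 * k) + w (Q (2 * k) l) := by
  rw [spineLabel, Even.neg_one_pow (even_two_mul k), one_mul]

theorem spineLabel_even_succ (w : ℕ → ℤ) (Q : ℕ → ℕ → ℕ) (l k : ℕ) :
    spineLabel w Q l (2 * (k + 1)) =
      spineLabel w Q l (2 * k + 1) - w (Q (2 * k + 1) l) := by
  rw [show 2 * (k + 1) = (2 * k + 1) + 1 by ring, spineLabel,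
    Odd.neg_one_pow (odd_two_mul_add_one k)]
  ring

theorem leafLabel_even (w : ℕ → ℤ) (Q : ℕ → ℕ → ℕ) (l k q : ℕ) :
    leafLabel w Q l (2 * k) q = spineLabel w Q l (2 * k) + w (Q (2 * k) q) := by
  rw [leafLabel, Even.neg_one_pow (even_two_mul k), one_mul]

theorem leafLabel_odd (w : ℕ → ℤ) (Q : ℕ → ℕ → ℕ) (l k q : ℕ) :
    leafLabel w Q l (2 * k + 1) q = spineLabel w Q l (2 * k + 1) - w (Q (2 * k + 1) q) := by
  rw [leafLabel, Odd.neg_one_pow (odd_two_mul_add_one k)]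
  ring

/-! ### Zigzag order of the labels -/

/-- The positions `Q` list the edges of the hairy cycle in the order of a zigzag along the cycle,
except for the leaves in `Mv`, whose labels fall next to the cycle vertex `2 * k₀ + 1`. -/
structure IsZigzag (w : ℕ → ℤ) (Q : ℕ → ℕ → ℕ) (t l k₀ : ℕ) (Mv : ℕ → ℕ → Prop) : Prop where
  anti : ∀ i j, i < j → w j < w i
  pos : ∀ j < 2 * t, ∀ r ≤ l, 0 < w (Q j r)
  inj : ∀ j < 2 * t, ∀ r ≤ l, ∀ j' < 2 * t, ∀ r' ≤ l, Q j r = Q j' r' → j = j' ∧ r = r'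
  spine : ∀ j, j + 2 < 2 * t → Q j l < Q (j + 1) l
  odd : ∀ k < t, ∀ q < l, Q (2 * k) l < Q (2 * k + 1) q ∧
    (k + 1 < t → Q (2 * k + 1) q < Q (2 * k + 1) l)
  even_lt : ∀ k < t, ∀ q < l, ¬ Mv k q → Q (2 * k) q < Q (2 * k) l
  lt_even : ∀ k, k + 1 < t → ∀ q < l, ¬ Mv (k + 1) q → Q (2 * k + 1) l < Q (2 * (k + 1)) q
  mv_index : ∀ k < t, ∀ q < l, Mv k q → 1 ≤ k₀ ∧ k₀ < t ∧ ∀ q' < l, ¬ Mv k₀ q'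
  lt_mv : ∀ k < t, ∀ q < l, Mv k q → spineLabel w Q l (2 * k₀ + 1) < leafLabel w Q l (2 * k) q
  mv_lt : ∀ k < t, ∀ q < l, Mv k q → leafLabel w Q l (2 * k) q < spineLabel w Q l (2 * k₀ - 1)
  mv_ne : ∀ k < t, ∀ q < l, Mv k q → ∀ q' < l,
    leafLabel w Q l (2 * k) q ≠ leafLabel w Q l (2 * k₀) q'
  mv_inj : ∀ k < t, ∀ q < l, ∀ k' < t, ∀ q' < l, Mv k q → Mv k' q' →
    leafLabel w Q l (2 * k) q = leafLabel w Q l (2 * k') q' → k = k' ∧ q = q'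

namespace IsZigzag

variable {w : ℕ → ℤ} {Q : ℕ → ℕ → ℕ} {t l k₀ : ℕ} {Mv : ℕ → ℕ → Prop}

theorem apply_inj (h : IsZigzag w Q t l k₀ Mv) {i j : ℕ} (hij : w i = w j) : i = j := by
  rcases Nat.lt_trichotomy i j with h1 | h1 | h1
  · have := h.anti _ _ h1; omega
  · exact h1
  · have := h.anti _ _ h1; omega

theorem even_le (h : IsZigzag w Q t l k₀ Mv) {k k' : ℕ} (hk : k ≤ k') (hk' : k' < t) :
    spineLabel w Q l (2 * k) ≤ spineLabel w Q l (2 * k') := by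
  induction k', hk using Nat.le_induction with
  | base => exact le_rfl
  | succ n hn ih =>
    have := ih (by omega)
    have h1 := h.anti _ _ (h.spine (2 * n) (by omega))
    rw [spineLabel_even_succ, spineLabel_odd]
    omega

theorem odd_le (h : IsZigzag w Q t l k₀ Mv) {k k' : ℕ} (hk : k ≤ k') (hk' : k' < t) :
    spineLabel w Q l (2 * k' + 1) ≤ spineLabel w Q l (2 * k + 1) := by
  induction k', hk using Nat.le_induction with
  | base => exact le_rfl
  | succ n hn ih =>
    have := ih (by omega)
    have h1 := h.anti _ _ (h.spine (2 * n + 1) (by omega))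
    rw [spineLabel_odd, spineLabel_even_succ]
    rw [show 2 * (n + 1) = 2 * n + 1 + 1 by ring]
    omega

/-- The even labels increase and the odd ones decrease, so only the last even and last odd vertex
need comparing; they differ by a positive term. -/
theorem even_lt_odd (h : IsZigzag w Q t l k₀ Mv) {k k' : ℕ} (hk : k < t) (hk' : k' < t) :
    spineLabel w Q l (2 * k) < spineLabel w Q l (2 * k' + 1) := by
  have h1 := h.even_le (show k ≤ t - 1 by omega) (by omega)
  have h2 := h.odd_le (show k' ≤ t - 1 by omega) (by omega)
  have h3 := h.pos (2 * (t - 1)) (by omega) l le_rfl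
  have h4 := spineLabel_odd w Q l (t - 1)
  omega

theorem lt_oddLeaf (h : IsZigzag w Q t l k₀ Mv) {k q : ℕ} (hk : k < t) (hq : q < l) :
    spineLabel w Q l (2 * k) < leafLabel w Q l (2 * k + 1) q := by
  have h1 := h.anti _ _ (h.odd k hk q hq).1
  rw [leafLabel_odd, spineLabel_odd]
  omega

theorem oddLeaf_lt (h : IsZigzag w Q t l k₀ Mv) {k k' q : ℕ} (hk : k < k') (hk' : k' < t)
    (hq : q < l) : leafLabel w Q l (2 * k + 1) q < spineLabel w Q l (2 * k') := by
  have h1 := h.anti _ _ ((h.odd k (by omega) q hq).2 (by omega))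
  have h2 := h.even_le (show k + 1 ≤ k' by omega) hk'
  have h3 := spineLabel_even_succ w Q l k
  rw [leafLabel_odd]
  omega

theorem oddLeaf_lt_odd (h : IsZigzag w Q t l k₀ Mv) {k k' q : ℕ} (hk : k < t) (hk' : k' < t)
    (hq : q < l) : leafLabel w Q l (2 * k + 1) q < spineLabel w Q l (2 * k' + 1) := by
  rcases Nat.lt_or_ge k (t - 1) with h1 | h1
  · exact (h.oddLeaf_lt h1 (by omega) hq).trans (h.even_lt_odd (by omega) hk')
  -- For the last vertex no even cycle vertex lies above its leaves: its outgoing edge is the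
  -- closing one, outside the order. Here the leaf is below its own vertex, the lowest odd one.
  · have h2 := h.odd_le (show k' ≤ k by omega) hk
    have h3 := h.pos (2 * k + 1) (by omega) q hq.le
    rw [leafLabel_odd]
    omega

theorem odd_lt_evenLeaf (h : IsZigzag w Q t l k₀ Mv) {k q : ℕ} (hk : k < t) (hq : q < l)
    (hM : ¬ Mv k q) : spineLabel w Q l (2 * k + 1) < leafLabel w Q l (2 * k) q := by
  have h1 := h.anti _ _ (h.even_lt k hk q hq hM)
  rw [leafLabel_even, spineLabel_odd]
  omega

theorem evenLeaf_lt_odd (h : IsZigzag w Q t l k₀ Mv) {k k' q : ℕ} (hk : k < k') (hk' : k' < t)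
    (hq : q < l) (hM : ¬ Mv k' q) :
    leafLabel w Q l (2 * k') q < spineLabel w Q l (2 * k + 1) := by
  obtain ⟨n, rfl⟩ : ∃ n, k' = n + 1 := ⟨k' - 1, by omega⟩
  have h1 := h.anti _ _ (h.lt_even n hk' q hq hM)
  have h2 := h.odd_le (show k ≤ n by omega) (by omega)
  rw [leafLabel_even, spineLabel_even_succ]
  omega

theorem top_lt_evenLeaf (h : IsZigzag w Q t l k₀ Mv) {k q : ℕ} (hk : k < t) (hq : q < l) :
    spineLabel w Q l (2 * (t - 1) + 1) < leafLabel w Q l (2 * k) q := by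
  by_cases hM : Mv k q
  · have h1 := h.lt_mv k hk q hq hM
    have h2 := h.odd_le (show k₀ ≤ t - 1 by have := h.mv_index k hk q hq hM; omega) (by omega)
    omega
  · have h1 := h.odd_lt_evenLeaf hk hq hM
    have h2 := h.odd_le (show k ≤ t - 1 by omega) (by omega)
    omega

theorem mv_lt_odd (h : IsZigzag w Q t l k₀ Mv) {k q n : ℕ} (hk : k < t) (hq : q < l)
    (hM : Mv k q) (hn : n < k₀) : leafLabel w Q l (2 * k) q < spineLabel w Q l (2 * n + 1) := by
  have h1 := h.mv_lt k hk q hq hM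
  obtain ⟨h2, h3, -⟩ := h.mv_index k hk q hq hM
  have h4 := h.odd_le (show n ≤ k₀ - 1 by omega) (by omega)
  rw [show 2 * (k₀ - 1) + 1 = 2 * k₀ - 1 by omega] at h4
  omega

theorem odd_lt_mv (h : IsZigzag w Q t l k₀ Mv) {k q n : ℕ} (hk : k < t) (hq : q < l)
    (hM : Mv k q) (hn : k₀ ≤ n) (hnt : n < t) :
    spineLabel w Q l (2 * n + 1) < leafLabel w Q l (2 * k) q := by
  have h1 := h.lt_mv k hk q hq hM
  have h4 := h.odd_le hn hnt
  omega

theorem evenLeaf_ne_odd (h : IsZigzag w Q t l k₀ Mv) {k q n : ℕ} (hk : k < t) (hq : q < l)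
    (hn : n < t) : leafLabel w Q l (2 * k) q ≠ spineLabel w Q l (2 * n + 1) := by
  by_cases hM : Mv k q
  · rcases Nat.lt_or_ge n k₀ with h1 | h1
    · exact (h.mv_lt_odd hk hq hM h1).ne
    · exact (h.odd_lt_mv hk hq hM h1 hn).ne'
  · rcases Nat.lt_or_ge n k with h1 | h1
    · exact (h.evenLeaf_lt_odd h1 hk hq hM).ne
    · exact ((h.odd_le h1 hn).trans_lt (h.odd_lt_evenLeaf hk hq hM)).ne'

/-- The moved leaf lies between the odd cycle vertices $2k_0+1$ and $2k_0-1$, where the only unmoved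
leaves of even vertices are those of $2k_0$; `mv_ne` excludes these. -/
theorem mv_ne_evenLeaf (h : IsZigzag w Q t l k₀ Mv) {k q k' q' : ℕ} (hk : k < t) (hq : q < l)
    (hk' : k' < t) (hq' : q' < l) (hM : Mv k q) (hM' : ¬ Mv k' q') :
    leafLabel w Q l (2 * k) q ≠ leafLabel w Q l (2 * k') q' := by
  rcases Nat.lt_trichotomy k' k₀ with h1 | rfl | h1
  · exact ((h.mv_lt_odd hk hq hM h1).trans (h.odd_lt_evenLeaf hk' hq' hM')).ne
  · exact h.mv_ne k hk q hq hM q' hq'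
  · exact ((h.evenLeaf_lt_odd h1 hk' hq' hM').trans
      (h.odd_lt_mv hk hq hM le_rfl (by omega))).ne'

theorem evenLeaf_inj (h : IsZigzag w Q t l k₀ Mv) {k q k' q' : ℕ} (hk : k < t) (hq : q < l)
    (hk' : k' < t) (hq' : q' < l)
    (heq : leafLabel w Q l (2 * k) q = leafLabel w Q l (2 * k') q') : k = k' ∧ q = q' := by
  by_cases hM : Mv k q <;> by_cases hM' : Mv k' q'
  · exact h.mv_inj k hk q hq k' hk' q' hq' hM hM' heq
  · exact absurd heq (h.mv_ne_evenLeaf hk hq hk' hq' hM hM')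
  · exact absurd heq.symm (h.mv_ne_evenLeaf hk' hq' hk hq hM' hM)
  · rcases Nat.lt_trichotomy k k' with h1 | rfl | h1
    · have h2 := h.odd_lt_evenLeaf hk hq hM
      have h3 := h.evenLeaf_lt_odd h1 hk' hq' hM'
      omega
    · rw [leafLabel_even, leafLabel_even] at heq
      have h1 := h.inj (2 * k) (by omega) q hq.le (2 * k) (by omega) q' hq'.le
        (h.apply_inj (by omega))
      exact ⟨rfl, h1.2⟩
    · have h2 := h.odd_lt_evenLeaf hk' hq' hM'
      have h3 := h.evenLeaf_lt_odd h1 hk hq hM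
      omega

theorem oddLeaf_inj (h : IsZigzag w Q t l k₀ Mv) {k q k' q' : ℕ} (hk : k < t) (hq : q < l)
    (hk' : k' < t) (hq' : q' < l)
    (heq : leafLabel w Q l (2 * k + 1) q = leafLabel w Q l (2 * k' + 1) q') :
    k = k' ∧ q = q' := by
  rcases Nat.lt_trichotomy k k' with h1 | rfl | h1
  · have h2 := h.oddLeaf_lt h1 hk' hq
    have h3 := h.lt_oddLeaf hk' hq'
    omega
  · rw [leafLabel_odd, leafLabel_odd] at heq
    have h1 := h.inj (2 * k + 1) (by omega) q hq.le (2 * k + 1) (by omega) q' hq'.le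
      (h.apply_inj (by omega))
    exact ⟨rfl, h1.2⟩
  · have h2 := h.oddLeaf_lt h1 hk hq'
    have h3 := h.lt_oddLeaf hk hq
    omega

theorem oddLeaf_ne_even (h : IsZigzag w Q t l k₀ Mv) {k q n : ℕ} (hk : k < t) (hq : q < l)
    (hn : n < t) : leafLabel w Q l (2 * k + 1) q ≠ spineLabel w Q l (2 * n) := by
  rcases Nat.lt_or_ge k n with h1 | h1
  · exact (h.oddLeaf_lt h1 hn hq).ne
  · exact ((h.even_le h1 hk).trans_lt (h.lt_oddLeaf hk hq)).ne'

theorem even_inj (h : IsZigzag w Q t l k₀ Mv) {k k' : ℕ} (hk : k < t) (hk' : k' < t)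
    (heq : spineLabel w Q l (2 * k) = spineLabel w Q l (2 * k')) : k = k' := by
  have aux : ∀ a b, a < b → b < t → spineLabel w Q l (2 * a) < spineLabel w Q l (2 * b) := by
    intro a b hab hb
    have h1 := h.anti _ _ (h.spine (2 * a) (by omega))
    have h2 := h.even_le (show a + 1 ≤ b by omega) hb
    rw [spineLabel_even_succ, spineLabel_odd] at h2
    omega
  rcases Nat.lt_trichotomy k k' with h1 | h1 | h1
  · have := aux _ _ h1 hk'; omega
  · exact h1
  · have := aux _ _ h1 hk; omega

theorem odd_inj (h : IsZigzag w Q t l k₀ Mv) {k k' : ℕ} (hk : k < t) (hk' : k' < t)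
    (heq : spineLabel w Q l (2 * k + 1) = spineLabel w Q l (2 * k' + 1)) : k = k' := by
  have aux : ∀ a b, a < b → b < t →
      spineLabel w Q l (2 * b + 1) < spineLabel w Q l (2 * a + 1) := by
    intro a b hab hb
    have h1 := h.anti _ _ (h.spine (2 * a + 1) (by omega))
    have h2 := h.odd_le (show a + 1 ≤ b by omega) hb
    rw [spineLabel_odd w Q l (a + 1), spineLabel_even_succ,
      show 2 * (a + 1) = 2 * a + 1 + 1 by ring] at h2
    omega
  rcases Nat.lt_trichotomy k k' with h1 | h1 | h1
  · have := aux _ _ h1 hk'; omega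
  · exact h1
  · have := aux _ _ h1 hk; omega

end IsZigzag

theorem fin_two_mul_cases {t : ℕ} (j : Fin (2 * t)) :
    ∃ k < t, j.val = 2 * k ∨ j.val = 2 * k + 1 :=
  ⟨j / 2, by have := j.2; omega, by omega⟩

/-- Each vertex of the hairy cycle has one of four kinds, given by the parity of its distance from
the cycle vertex `0` and by whether it lies on the cycle. -/
theorem hairyLabel_cases (w : ℕ → ℤ) (Q : ℕ → ℕ → ℕ) {t l : ℕ}
    (x : Fin (2 * t) ⊕ Fin (2 * t) × Fin l) :
    (x ∈ hairyEven t l ∧ ∃ k < t,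
      ((∃ j : Fin (2 * t), j.val = 2 * k ∧ x = .inl j ∧
          hairyLabel w Q t l x = spineLabel w Q l (2 * k)) ∨
        ∃ (j : Fin (2 * t)) (q : Fin l), j.val = 2 * k + 1 ∧ x = .inr (j, q) ∧
          hairyLabel w Q t l x = leafLabel w Q l (2 * k + 1) q)) ∨
    (x ∉ hairyEven t l ∧ ∃ k < t,
      ((∃ j : Fin (2 * t), j.val = 2 * k + 1 ∧ x = .inl j ∧
          hairyLabel w Q t l x = spineLabel w Q l (2 * k + 1)) ∨
        ∃ (j : Fin (2 * t)) (q : Fin l), j.val = 2 * k ∧ x = .inr (j, q) ∧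
          hairyLabel w Q t l x = leafLabel w Q l (2 * k) q)) := by
  rcases x with j | ⟨j, q⟩ <;> obtain ⟨k, hk, hj | hj⟩ := fin_two_mul_cases j
  · exact Or.inl ⟨by simp [hairyEven, hj], k, hk, Or.inl ⟨j, hj, rfl, by rw [hairyLabel, hj]⟩⟩
  · exact Or.inr ⟨by simp [hairyEven, hj, parity_simps], k, hk,
      Or.inl ⟨j, hj, rfl, by rw [hairyLabel, hj]⟩⟩
  · exact Or.inr ⟨by simp [hairyEven, hj], k, hk,
      Or.inr ⟨j, q, hj, rfl, by simp only [hairyLabel, hj]⟩⟩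
  · exact Or.inl ⟨by simp [hairyEven, hj, parity_simps], k, hk,
      Or.inr ⟨j, q, hj, rfl, by simp only [hairyLabel, hj]⟩⟩

namespace IsZigzag

variable {w : ℕ → ℤ} {Q : ℕ → ℕ → ℕ} {t l k₀ : ℕ} {Mv : ℕ → ℕ → Prop}

/-- The last cycle vertex carries the least label of the upper part, so it serves as the threshold
between the parts. -/
theorem hairyLabel_lt_top (h : IsZigzag w Q t l k₀ Mv) {x : Fin (2 * t) ⊕ Fin (2 * t) × Fin l}
    (hx : x ∈ hairyEven t l) : hairyLabel w Q t l x < spineLabel w Q l (2 * (t - 1) + 1) := by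
  rcases hairyLabel_cases w Q x with
    ⟨-, k, hk, ⟨j, -, -, e⟩ | ⟨j, q, -, -, e⟩⟩ | ⟨hx', -⟩
  · rw [e]; exact h.even_lt_odd hk (by omega)
  · rw [e]; exact h.oddLeaf_lt_odd hk (by omega) q.2
  · exact absurd hx hx'

theorem top_le_hairyLabel (h : IsZigzag w Q t l k₀ Mv) {x : Fin (2 * t) ⊕ Fin (2 * t) × Fin l}
    (hx : x ∉ hairyEven t l) : spineLabel w Q l (2 * (t - 1) + 1) ≤ hairyLabel w Q t l x := by
  rcases hairyLabel_cases w Q x with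
    ⟨hx', -⟩ | ⟨-, k, hk, ⟨j, -, -, e⟩ | ⟨j, q, -, -, e⟩⟩
  · exact absurd hx' hx
  · rw [e]; exact h.odd_le (by omega) (by omega)
  · rw [e]; exact (h.top_lt_evenLeaf hk q.2).le

theorem hairyLabel_lt (h : IsZigzag w Q t l k₀ Mv) {x y : Fin (2 * t) ⊕ Fin (2 * t) × Fin l}
    (hx : x ∈ hairyEven t l) (hy : y ∉ hairyEven t l) :
    hairyLabel w Q t l x < hairyLabel w Q t l y :=
  (h.hairyLabel_lt_top hx).trans_le (h.top_le_hairyLabel hy)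

theorem hairyLabel_injective (h : IsZigzag w Q t l k₀ Mv) :
    Function.Injective (hairyLabel w Q t l) := by
  intro x y hxy
  rcases hairyLabel_cases w Q x with
    ⟨hx, k, hk, ⟨j, hj, rx, e⟩ | ⟨j, q, hj, rx, e⟩⟩ |
      ⟨hx, k, hk, ⟨j, hj, rx, e⟩ | ⟨j, q, hj, rx, e⟩⟩ <;>
  rcases hairyLabel_cases w Q y with
    ⟨hy, k', hk', ⟨j', hj', ry, e'⟩ | ⟨j', q', hj', ry, e'⟩⟩ |
      ⟨hy, k', hk', ⟨j', hj', ry, e'⟩ | ⟨j', q', hj', ry, e'⟩⟩ <;>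
  first
  | exact absurd hxy (h.hairyLabel_lt hx hy).ne
  | exact absurd hxy (h.hairyLabel_lt hy hx).ne'
  | skip
  all_goals rw [e, e'] at hxy
  · rw [rx, ry, Fin.ext (a := j) (b := j') (by have := h.even_inj hk hk' hxy; omega)]
  · exact absurd hxy.symm (h.oddLeaf_ne_even hk' q'.2 hk)
  · exact absurd hxy (h.oddLeaf_ne_even hk q.2 hk')
  · have := h.oddLeaf_inj hk q.2 hk' q'.2 hxy
    rw [rx, ry, Fin.ext (a := j) (b := j') (by omega), Fin.ext (a := q) (b := q') this.2]
  · rw [rx, ry, Fin.ext (a := j) (b := j') (by have := h.odd_inj hk hk' hxy; omega)]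
  · exact absurd hxy.symm (h.evenLeaf_ne_odd hk' q'.2 hk)
  · exact absurd hxy (h.evenLeaf_ne_odd hk q.2 hk')
  · have := h.evenLeaf_inj hk q.2 hk' q'.2 hxy
    rw [rx, ry, Fin.ext (a := j) (b := j') (by omega), Fin.ext (a := q) (b := q') this.2]

theorem hairyLabel_nonneg (h : IsZigzag w Q t l k₀ Mv)
    (x : Fin (2 * t) ⊕ Fin (2 * t) × Fin l) : 0 ≤ hairyLabel w Q t l x := by
  have h0 : spineLabel w Q l (2 * 0) = 0 := rfl
  rcases hairyLabel_cases w Q x with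
    ⟨hx, k, hk, ⟨j, hj, rx, e⟩ | ⟨j, q, hj, rx, e⟩⟩ | ⟨hx, k, hk, -⟩
  · rw [e, ← h0]; exact h.even_le (Nat.zero_le k) hk
  · rw [e, ← h0]; exact (h.even_le (Nat.zero_le k) hk).trans (h.lt_oddLeaf hk q.2).le
  · rw [← h0]
    exact ((h.even_lt_odd (by omega) (by omega)).trans_le (h.top_le_hairyLabel hx)).le

theorem hairyLabel_le (h : IsZigzag w Q t l k₀ Mv)
    (x : Fin (2 * t) ⊕ Fin (2 * t) × Fin l) : hairyLabel w Q t l x ≤ w 0 := by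
  have hw : ∀ i, w i ≤ w 0 := by
    intro i
    rcases Nat.eq_zero_or_pos i with rfl | hi
    · exact le_rfl
    · exact (h.anti _ _ hi).le
  have h1 : spineLabel w Q l (2 * 0 + 1) ≤ w 0 := by
    have h0 : spineLabel w Q l (2 * 0) = 0 := rfl
    rw [spineLabel_odd, h0, zero_add]
    exact hw _
  rcases hairyLabel_cases w Q x with ⟨hx, k, hk, -⟩ |
    ⟨hx, k, hk, ⟨j, hj, rx, e⟩ | ⟨j, q, hj, rx, e⟩⟩
  · exact ((h.hairyLabel_lt_top hx).trans_le (h.odd_le (Nat.zero_le _) (by omega))).le.trans h1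
  · rw [e]; exact (h.odd_le (Nat.zero_le k) hk).trans h1
  · rw [e]
    by_cases hM : Mv k q
    · exact (h.mv_lt_odd hk q.2 hM (n := 0) (h.mv_index k hk q q.2 hM).1).le.trans h1
    rcases Nat.eq_zero_or_pos k with rfl | hk0
    · have h0 : spineLabel w Q l (2 * 0) = 0 := rfl
      rw [leafLabel_even, h0, zero_add]
      exact hw _
    · exact (h.evenLeaf_lt_odd hk0 hk q.2 hM).le.trans h1

theorem isDivisibleAlphaLabeling {d m : ℕ} (h : IsZigzag (admissibleDiff d m) Q t l k₀ Mv)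
    (ht : 2 ≤ t) (hd : 0 < d) (hm : 0 < m) (he : 2 * t * (l + 1) = d * m)
    (hQlt : ∀ j < 2 * t, ∀ r ≤ l, Q j r < d * m)
    (hQsurj : ∀ i < d * m, ∃ j < 2 * t, ∃ r ≤ l, Q j r = i)
    (hclose : spineLabel (admissibleDiff d m) Q l (2 * t - 1) =
      admissibleDiff d m (Q (2 * t - 1) l)) :
    (hairyCycle t l).IsDivisibleAlphaLabeling d
      (fun x => (hairyLabel (admissibleDiff d m) Q t l x).toNat) := by
  refine isDivisibleAlphaLabeling_hairyLabel ht hd hm he hQlt hQsurj hclose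
    h.hairyLabel_injective h.hairyLabel_nonneg ?_ fun a ha b hb => h.hairyLabel_lt ha hb
  intro x
  refine (h.hairyLabel_le x).trans (le_of_eq ?_)
  simp [admissibleDiff]

end IsZigzag

/-! ### The permutation of the edge positions -/

/-- A permutation of the positions below `T - 1`. If `a = 1` the position `T - 2 L - 2` is carried
just in front of the position `T - L - 1`; otherwise it is the identity. -/
def lowerShift (T L a x : ℕ) : ℕ :=
  if a = 1 ∧ x + 2 * L + 2 = T then x + L
  else if a = 1 ∧ T ≤ x + 2 * L + 1 ∧ x + L + 2 ≤ T then x - 1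
  else x

/-- A permutation of the positions `T - 1, ..., 2 T - 1`, a cyclic shift which is modified around
`T + L` if `b = 1`. -/
def upperShift (T L b c x : ℕ) : ℕ :=
  if b = 1 ∧ x + 1 = T + L then x + 2
  else if b = 1 ∧ x = T + L then x - c
  else if b = 1 ∧ x + 2 = T + L then x + 1 + c
  else if x + 1 = 2 * T then T - 1
  else x + 1

/-- The permutation of the positions `0, ..., 2 T - 1` composed of `lowerShift` and
`upperShift`. -/
def edgeShift (T L a b c x : ℕ) : ℕ :=
  if x + 1 < T then lowerShift T L a x else upperShift T L b c x

/-- The position in the list of differences of the edge `r` at the cycle vertex `j`. -/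
def edgePos (t l a b c j r : ℕ) : ℕ := edgeShift (t * (l + 1)) (l + 1) a b c (j * (l + 1) + r)

/-- The leaves whose positions in the list of differences leave the zigzag order. -/
def isMoved (l a b k₀ k q : ℕ) : Prop := (a = 1 ∧ k + 1 = k₀ ∧ q + 1 = l) ∨ (b = 1 ∧ k = k₀ + 1 ∧ q = 0)

section

variable {T L a b c : ℕ}

theorem lowerShift_lt (hL : 2 ≤ L) {x : ℕ} (hx : x + 1 < T) : lowerShift T L a x + 1 < T := by
  unfold lowerShift
  split_ifs <;> omega

theorem le_upperShift (hL : 2 ≤ L) (hc : c ≤ 1) {x : ℕ} (hx : T ≤ x + 1) :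
    T ≤ upperShift T L b c x + 1 := by
  unfold upperShift
  split_ifs <;> omega

theorem upperShift_lt (hb : b = 1 → 3 * L ≤ T) (hL : 2 ≤ L) {x : ℕ} (hc : c ≤ 1)
    (hx : x < 2 * T) : upperShift T L b c x < 2 * T := by
  unfold upperShift
  split_ifs <;> omega

theorem lowerShift_inj (hL : 2 ≤ L) {x y : ℕ} (h : lowerShift T L a x = lowerShift T L a y)
    (ha : a = 1 → 3 * L ≤ T) : x = y := by
  unfold lowerShift at h
  split_ifs at h <;> omega

theorem upperShift_inj (hL : 2 ≤ L) (hc : c ≤ 1) (hb : b = 1 → 3 * L ≤ T) {x y : ℕ}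
    (hx : T ≤ x + 1) (hy : T ≤ y + 1) (h : upperShift T L b c x = upperShift T L b c y) :
    x = y := by
  unfold upperShift at h
  split_ifs at h <;> omega

theorem edgeShift_lt (hL : 2 ≤ L) (hc : c ≤ 1) (hb : b = 1 → 3 * L ≤ T) {x : ℕ}
    (hx : x < 2 * T) : edgeShift T L a b c x < 2 * T := by
  unfold edgeShift
  split_ifs with h
  · have := lowerShift_lt (a := a) hL h
    omega
  · exact upperShift_lt hb hL hc hx

theorem edgeShift_inj (hL : 2 ≤ L) (hc : c ≤ 1) (ha : a = 1 → 3 * L ≤ T)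
    (hb : b = 1 → 3 * L ≤ T) {x y : ℕ}
    (hxy : edgeShift T L a b c x = edgeShift T L a b c y) : x = y := by
  unfold edgeShift at hxy
  split_ifs at hxy with h1 h2 h2
  · exact lowerShift_inj hL hxy ha
  · have h3 := lowerShift_lt (a := a) hL h1
    have h4 := le_upperShift (b := b) hL hc (not_lt.1 h2)
    omega
  · have h3 := lowerShift_lt (a := a) hL h2
    have h4 := le_upperShift (b := b) hL hc (not_lt.1 h1)
    omega
  · exact upperShift_inj hL hc hb (not_lt.1 h1) (not_lt.1 h2) hxy

theorem edgeShift_surj (hL : 2 ≤ L) (hc : c ≤ 1) (ha : a = 1 → 3 * L ≤ T)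
    (hb : b = 1 → 3 * L ≤ T) {i : ℕ} (hi : i < 2 * T) :
    ∃ x < 2 * T, edgeShift T L a b c x = i := by
  have h : Function.Surjective (fun x : Fin (2 * T) =>
      (⟨edgeShift T L a b c x, edgeShift_lt hL hc hb x.2⟩ : Fin (2 * T))) := by
    apply Finite.surjective_of_injective
    intro x y hxy
    exact Fin.ext (edgeShift_inj hL hc ha hb (Fin.mk.inj hxy))
  obtain ⟨x, hx⟩ := h ⟨i, hi⟩
  exact ⟨x, x.2, Fin.mk.inj hx⟩

end

/-- Supplies linear facts about the products $jL$ and $tL$, so that once these are generalized to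
variables `omega` can decide every position comparison near the middle. -/
theorem block_cases (j t L : ℕ) :
    (j + 4 ≤ t ∧ j * L + 4 * L ≤ t * L) ∨ (j + 3 = t ∧ j * L + 3 * L = t * L) ∨
      (j + 2 = t ∧ j * L + 2 * L = t * L) ∨ (j + 1 = t ∧ j * L + L = t * L) ∨
      (j = t ∧ j * L = t * L) ∨ (j = t + 1 ∧ j * L = t * L + L) ∨
      (t + 2 ≤ j ∧ t * L + 2 * L ≤ j * L) := by
  rcases (by omega : j + 4 ≤ t ∨ j + 3 = t ∨ j + 2 = t ∨ j + 1 = t ∨ j = t ∨ j = t + 1 ∨ t + 2 ≤ j)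
    with h | rfl | rfl | rfl | rfl | rfl | h
  · exact Or.inl ⟨h, by rw [← add_mul]; exact Nat.mul_le_mul_right L h⟩
  · exact Or.inr (Or.inl ⟨rfl, by ring⟩)
  · exact Or.inr (Or.inr (Or.inl ⟨rfl, by ring⟩))
  · exact Or.inr (Or.inr (Or.inr (Or.inl ⟨rfl, by ring⟩)))
  · exact Or.inr (Or.inr (Or.inr (Or.inr (Or.inl ⟨rfl, rfl⟩))))
  · exact Or.inr (Or.inr (Or.inr (Or.inr (Or.inr (Or.inl ⟨rfl, by ring⟩)))))
  · exact Or.inr (Or.inr (Or.inr (Or.inr (Or.inr (Or.inr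
      ⟨h, by rw [← add_mul]; exact Nat.mul_le_mul_right L h⟩)))))

section

variable {t l a b c k₀ : ℕ}

theorem block_add_lt {j r : ℕ} (hj : j < 2 * t) (hr : r ≤ l) :
    j * (l + 1) + r < 2 * (t * (l + 1)) := by
  have := Nat.mul_le_mul_right (l + 1) (show j + 1 ≤ 2 * t from hj)
  rw [add_mul, mul_assoc] at this
  omega

theorem edgePos_lt (hl : 1 ≤ l) (hc : c ≤ 1) (hb : b = 1 → 3 ≤ t) {j r : ℕ}
    (hj : j < 2 * t) (hr : r ≤ l) : edgePos t l a b c j r < 2 * (t * (l + 1)) :=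
  edgeShift_lt (by omega) hc (fun h => Nat.mul_le_mul_right _ (hb h)) (block_add_lt hj hr)

theorem edgePos_inj (hl : 1 ≤ l) (hc : c ≤ 1) (ha : a = 1 → 3 ≤ t) (hb : b = 1 → 3 ≤ t)
    {j r j' r' : ℕ} (hr : r ≤ l) (hr' : r' ≤ l)
    (h : edgePos t l a b c j r = edgePos t l a b c j' r') : j = j' ∧ r = r' := by
  have h1 := edgeShift_inj (by omega) hc (fun h => Nat.mul_le_mul_right _ (ha h))
    (fun h => Nat.mul_le_mul_right _ (hb h)) h
  have key : ∀ j r, r ≤ l → (j * (l + 1) + r) / (l + 1) = j := by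
    intro j r hr
    rw [mul_comm, Nat.mul_add_div (by omega), Nat.div_eq_of_lt (by omega), add_zero]
  have h2 : j = j' := by rw [← key j r hr, h1, key j' r' hr']
  subst h2
  exact ⟨rfl, by omega⟩

theorem edgePos_surj (hl : 1 ≤ l) (hc : c ≤ 1) (ha : a = 1 → 3 ≤ t) (hb : b = 1 → 3 ≤ t)
    {i : ℕ} (hi : i < 2 * (t * (l + 1))) :
    ∃ j < 2 * t, ∃ r ≤ l, edgePos t l a b c j r = i := by
  obtain ⟨x, hx, rfl⟩ := edgeShift_surj (a := a) (b := b) (c := c) (L := l + 1) (by omega) hc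
    (fun h => Nat.mul_le_mul_right _ (ha h)) (fun h => Nat.mul_le_mul_right _ (hb h)) hi
  refine ⟨x / (l + 1), ?_, x % (l + 1), ?_, ?_⟩
  · rw [Nat.div_lt_iff_lt_mul (by omega), mul_assoc]
    exact hx
  · have := Nat.mod_lt x (show 0 < l + 1 by omega)
    omega
  · rw [edgePos, Nat.div_add_mod']

theorem edgePos_closing (hl : 1 ≤ l) (ht : 2 ≤ t) (hb : b = 1 → 3 ≤ t) :
    edgePos t l a b c (2 * t - 1) l = t * (l + 1) - 1 := by
  have h1 := Nat.mul_le_mul_right (l + 1) ht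
  have h2 := fun h => Nat.mul_le_mul_right (l + 1) (hb h)
  have h3 : (2 * t - 1) * (l + 1) + l + 1 = 2 * (t * (l + 1)) := by
    obtain ⟨n, hn⟩ : ∃ n, 2 * t = n + 1 := ⟨2 * t - 1, by omega⟩
    rw [← mul_assoc, hn, Nat.add_sub_cancel]
    ring
  unfold edgePos
  generalize (2 * t - 1) * (l + 1) = X at *
  generalize t * (l + 1) = T at *
  unfold edgeShift upperShift
  rw [if_neg (by omega), if_neg (by omega), if_neg (by omega), if_neg (by omega),
    if_pos (by omega)]

theorem edgePos_spine (hl : 1 ≤ l) {j : ℕ} (hj : j + 1 < 2 * t) :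
    (a = 1 ∧ j + 3 = t ∧ edgePos t l a b c j l = j * (l + 1) + l - 1) ∨
    (¬ (a = 1 ∧ j + 3 = t) ∧ j + 1 < t ∧ edgePos t l a b c j l = j * (l + 1) + l) ∨
    (t ≤ j + 1 ∧ ¬ (b = 1 ∧ j = t) ∧ edgePos t l a b c j l = j * (l + 1) + l + 1) ∨
    (b = 1 ∧ j = t ∧ edgePos t l a b c j l = j * (l + 1) + l + 2) := by
  have h3 := block_add_lt (l := l) hj le_rfl
  have h5 : (j + 1) * (l + 1) = j * (l + 1) + (l + 1) := by ring
  have h4 := block_cases j t (l + 1)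
  unfold edgePos
  rw [h5] at h3
  generalize j * (l + 1) = X at *
  generalize t * (l + 1) = T at *
  unfold edgeShift
  by_cases hT : X + l + 1 < T
  · rw [if_pos hT]
    unfold lowerShift
    rw [if_neg (by omega)]
    split_ifs <;> omega
  · rw [if_neg hT]
    unfold upperShift
    rw [if_neg (c := b = 1 ∧ X + l = T + (l + 1)) (by omega),
      if_neg (c := b = 1 ∧ X + l + 2 = T + (l + 1)) (by omega), if_neg (c := _ = 2 * T) (by omega)]
    split_ifs <;> omega

theorem edgePos_leaf (hl : 1 ≤ l) {j q : ℕ} (hj : j < 2 * t) (hq : q < l)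
    (ha : ¬ (a = 1 ∧ j + 3 = t ∧ q + 1 = l)) (hb : ¬ (b = 1 ∧ j = t + 1 ∧ q = 0)) :
    (j < t ∧ edgePos t l a b c j q = j * (l + 1) + q) ∨
    (a = 1 ∧ j + 2 = t ∧ edgePos t l a b c j q = j * (l + 1) + q - 1) ∨
    (t ≤ j ∧ edgePos t l a b c j q = j * (l + 1) + q + 1) ∨
    (b = 1 ∧ j = t ∧ q + 1 = l ∧ edgePos t l a b c j q = j * (l + 1) + q + 1 + c) := by
  have h3 := block_add_lt (l := l) hj le_rfl
  have h4 := block_cases j t (l + 1)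
  unfold edgePos
  generalize j * (l + 1) = X at *
  generalize t * (l + 1) = T at *
  unfold edgeShift
  by_cases hT : X + q + 1 < T
  · rw [if_pos hT]
    unfold lowerShift
    rw [if_neg (by omega)]
    split_ifs <;> omega
  · rw [if_neg hT]
    unfold upperShift
    rw [if_neg (c := b = 1 ∧ X + q + 1 = T + (l + 1)) (by omega),
      if_neg (c := b = 1 ∧ X + q = T + (l + 1)) (by omega), if_neg (c := _ = 2 * T) (by omega)]
    split_ifs <;> omega

theorem edgePos_spine_lt (hl : 1 ≤ l) {j : ℕ} (hj : j + 2 < 2 * t) :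
    edgePos t l a b c j l < edgePos t l a b c (j + 1) l := by
  have h1 := edgePos_spine (a := a) (b := b) (c := c) hl (show j + 1 < 2 * t by omega)
  have h2 := edgePos_spine (a := a) (b := b) (c := c) hl (show j + 1 + 1 < 2 * t by omega)
  have h5 : (j + 1) * (l + 1) = j * (l + 1) + (l + 1) := by ring
  rw [h5] at h2
  omega

theorem edgePos_leaf_lt (hl : 1 ≤ l) (hc : c ≤ 1) {j q : ℕ}
    (hj : j + 1 < 2 * t) (hq : q < l)
    (ha : ¬ (a = 1 ∧ j + 3 = t ∧ q + 1 = l)) (hb : ¬ (b = 1 ∧ j = t + 1 ∧ q = 0)) :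
    edgePos t l a b c j q < edgePos t l a b c j l := by
  have h1 := edgePos_spine (a := a) (b := b) (c := c) hl hj
  have h2 := edgePos_leaf (c := c) hl (show j < 2 * t by omega) hq ha hb
  omega

theorem lt_edgePos_leaf (hl : 1 ≤ l) {j q : ℕ}
    (hj : j + 1 < 2 * t) (hq : q < l)
    (ha : ¬ (a = 1 ∧ j + 4 = t ∧ q + 1 = l)) (hb : ¬ (b = 1 ∧ j = t ∧ q = 0)) :
    edgePos t l a b c j l < edgePos t l a b c (j + 1) q := by
  have h1 := edgePos_spine (a := a) (b := b) (c := c) hl hj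
  have h2 := edgePos_leaf (a := a) (b := b) (c := c) hl hj hq (by omega) (by omega)
  have h5 : (j + 1) * (l + 1) = j * (l + 1) + (l + 1) := by ring
  rw [h5] at h2
  omega

theorem edgePos_moved_lower (ha : a = 1) (ht : 3 ≤ t) (hl : 1 ≤ l) :
    edgePos t l a b c (t - 3) (l - 1) = t * (l + 1) - (l + 1) - 2 := by
  obtain ⟨n, rfl⟩ : ∃ n, t = n + 3 := ⟨t - 3, by omega⟩
  have h5 : (n + 3) * (l + 1) = n * (l + 1) + 3 * (l + 1) := by ring
  unfold edgePos edgeShift lowerShift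
  rw [h5, Nat.add_sub_cancel, if_pos (by omega), if_pos (by omega)]
  omega

theorem edgePos_moved_upper (hb : b = 1) :
    edgePos t l a b c (t + 1) 0 = t * (l + 1) + (l + 1) - c := by
  have h5 : (t + 1) * (l + 1) = t * (l + 1) + (l + 1) := by ring
  unfold edgePos edgeShift upperShift
  rw [h5, if_neg (by omega), if_neg (by omega), if_pos (by omega), add_zero]

end

/-! ### The moved leaves, and verification of the zigzag -/

section

variable {w : ℕ → ℤ} {t l a b c k₀ : ℕ}

/-- Measuring from cycle vertex $2k_0=t-1$ makes the label comparable with its neighbours there: the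
leaves of that vertex use $w_i$ with $i\le T-2$, and its outgoing cycle edge uses $w_T$. -/
theorem leafLabel_moved_lower (hl : 1 ≤ l) (ha : a = 1) (hk₀ : t = 2 * k₀ + 1) {k q : ℕ}
    (hk : k + 1 = k₀) (hq : q + 1 = l) :
    leafLabel w (edgePos t l a b c) l (2 * k) q =
      spineLabel w (edgePos t l a b c) l (2 * k₀) +
        (w (t * (l + 1) - (l + 1) - 2) + w (t * (l + 1) - (l + 1) - 1) -
          w (t * (l + 1) - 2 * (l + 1) - 2)) := by
  subst hk
  have h1 := edgePos_spine (a := a) (b := b) (c := c) hl (show 2 * k + 1 < 2 * t by omega)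
  have h2 := edgePos_spine (a := a) (b := b) (c := c) hl (show 2 * k + 1 + 1 < 2 * t by omega)
  have h3 : (2 * k + 1) * (l + 1) = 2 * k * (l + 1) + (l + 1) := by ring
  have h4 : t * (l + 1) = 2 * k * (l + 1) + 3 * (l + 1) := by rw [hk₀]; ring
  have h5 := edgePos_moved_lower (b := b) (c := c) ha (show 3 ≤ t by omega) hl
  rw [show t - 3 = 2 * k by omega, show l - 1 = q by omega] at h5
  rw [h3] at h2
  rw [leafLabel_even, spineLabel_even_succ, spineLabel_odd, h5,
    show edgePos t l a b c (2 * k) l = t * (l + 1) - 2 * (l + 1) - 2 by omega,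
    show edgePos t l a b c (2 * k + 1) l = t * (l + 1) - (l + 1) - 1 by omega]
  ring

theorem leafLabel_moved_upper (hl : 1 ≤ l) (hb : b = 1) (hk₀ : t = 2 * k₀ + 1) (h0 : 1 ≤ k₀) :
    leafLabel w (edgePos t l a b c) l (2 * (k₀ + 1)) 0 =
      spineLabel w (edgePos t l a b c) l (2 * k₀) +
        (w (t * (l + 1)) + w (t * (l + 1) + (l + 1) - c) - w (t * (l + 1) + (l + 1) + 1)) := by
  have h1 := edgePos_spine (a := a) (b := b) (c := c) hl (show 2 * k₀ + 1 < 2 * t by omega)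
  have h2 := edgePos_spine (a := a) (b := b) (c := c) hl (show 2 * k₀ + 1 + 1 < 2 * t by omega)
  have h3 : (2 * k₀ + 1) * (l + 1) = 2 * k₀ * (l + 1) + (l + 1) := by ring
  have h4 : t * (l + 1) = 2 * k₀ * (l + 1) + (l + 1) := by rw [hk₀]; ring
  have h5 := edgePos_moved_upper (t := t) (l := l) (a := a) (c := c) hb
  rw [show t + 1 = 2 * (k₀ + 1) by omega] at h5
  rw [h3] at h2
  rw [leafLabel_even, spineLabel_even_succ, spineLabel_odd, h5,
    show edgePos t l a b c (2 * k₀) l = t * (l + 1) by omega,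
    show edgePos t l a b c (2 * k₀ + 1) l = t * (l + 1) + (l + 1) + 1 by omega]
  ring

theorem isZigzag_edgePos (hl : 1 ≤ l) (ht : 2 ≤ t) (hc : c ≤ 1)
    (hk₀ : a = 1 ∨ b = 1 → t = 2 * k₀ + 1) (hw : ∀ i j, i < j → w j < w i)
    (hpos : ∀ i < 2 * (t * (l + 1)), 0 < w i)
    (ha : a = 1 →
      w (t * (l + 1)) < w (t * (l + 1) - (l + 1) - 2) + w (t * (l + 1) - (l + 1) - 1) -
          w (t * (l + 1) - 2 * (l + 1) - 2) ∧
      w (t * (l + 1) - (l + 1) - 2) + w (t * (l + 1) - (l + 1) - 1) -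
          w (t * (l + 1) - 2 * (l + 1) - 2) < w (t * (l + 1) - 2))
    (hb : b = 1 →
      w (t * (l + 1)) < w (t * (l + 1)) + w (t * (l + 1) + (l + 1) - c) -
          w (t * (l + 1) + (l + 1) + 1) ∧
      w (t * (l + 1)) + w (t * (l + 1) + (l + 1) - c) -
          w (t * (l + 1) + (l + 1) + 1) < w (t * (l + 1) - 2))
    (hab : a = 1 → b = 1 →
      w (t * (l + 1) - (l + 1) - 2) + w (t * (l + 1) - (l + 1) - 1) -
          w (t * (l + 1) - 2 * (l + 1) - 2) ≠
      w (t * (l + 1)) + w (t * (l + 1) + (l + 1) - c) - w (t * (l + 1) + (l + 1) + 1)) :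
    IsZigzag w (edgePos t l a b c) t l k₀ (isMoved l a b k₀) := by
  have ha3 : a = 1 → 3 ≤ t := fun h => by have := hk₀ (Or.inl h); omega
  have hb3 : b = 1 → 3 ≤ t := fun h => by have := hk₀ (Or.inr h); omega
  have hlab : ∀ k q, isMoved l a b k₀ k q → t = 2 * k₀ + 1 ∧ ∃ z, w (t * (l + 1)) < z ∧
      z < w (t * (l + 1) - 2) ∧ leafLabel w (edgePos t l a b c) l (2 * k) q =
        spineLabel w (edgePos t l a b c) l (2 * k₀) + z := by
    rintro k q (⟨h1, h2, h3⟩ | ⟨h1, rfl, rfl⟩)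
    · have h4 := hk₀ (Or.inl h1)
      exact ⟨h4, _, (ha h1).1, (ha h1).2, leafLabel_moved_lower hl h1 h4 h2 h3⟩
    · have h4 := hk₀ (Or.inr h1)
      exact ⟨h4, _, (hb h1).1, (hb h1).2, leafLabel_moved_upper hl h1 h4 (by omega)⟩
  have hwle : ∀ i j, i ≤ j → w j ≤ w i := by
    intro i j hij
    rcases hij.eq_or_lt with rfl | h
    · exact le_rfl
    · exact (hw _ _ h).le
  constructor
  · exact hw
  · exact fun j hj r hr => hpos _ (edgePos_lt hl hc hb3 hj hr)
  · exact fun j _ r hr j' _ r' hr' h => edgePos_inj hl hc ha3 hb3 hr hr' h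
  · exact fun j hj => edgePos_spine_lt hl hj
  -- Moved leaves hang from the vertices $t-3$ and $t+1$, both even as $t$ is odd, so odd vertices
  -- keep the order.
  · intro k hk q hq
    exact ⟨lt_edgePos_leaf hl (by omega) hq (by omega) (by omega),
      fun h => edgePos_leaf_lt hl hc (by omega) hq (by omega) (by omega)⟩
  · intro k hk q hq hM
    unfold isMoved at hM
    exact edgePos_leaf_lt hl hc (by omega) hq (by omega) (by omega)
  · intro k hk q hq hM
    unfold isMoved at hM
    rw [show 2 * (k + 1) = 2 * k + 1 + 1 by ring]
    exact lt_edgePos_leaf hl (by omega) hq (by omega) (by omega)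
  · intro k hk q hq hM
    have h1 := (hlab k q hM).1
    unfold isMoved at hM ⊢
    exact ⟨by omega, by omega, fun q' _ => by omega⟩
  · intro k hk q hq hM
    obtain ⟨h1, z, h2, h3, h4⟩ := hlab k q hM
    have h5 := edgePos_spine (a := a) (b := b) (c := c) hl (show 2 * k₀ + 1 < 2 * t by omega)
    have h6 : t * (l + 1) = 2 * k₀ * (l + 1) + (l + 1) := by rw [h1]; ring
    rw [h4, spineLabel_odd, show edgePos t l a b c (2 * k₀) l = t * (l + 1) by omega]
    omega
  · intro k hk q hq hM
    obtain ⟨h1, z, h2, h3, h4⟩ := hlab k q hM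
    obtain ⟨n, rfl⟩ : ∃ n, k₀ = n + 1 := ⟨k₀ - 1, by omega⟩
    have h5 := edgePos_spine (a := a) (b := b) (c := c) hl (show 2 * n + 1 + 1 < 2 * t by omega)
    have h6 : t * (l + 1) = (2 * n + 1) * (l + 1) + 2 * (l + 1) := by rw [h1]; ring
    have h7 := hwle (edgePos t l a b c (2 * n + 1) l) (t * (l + 1) - 2) (by omega)
    rw [h4, show 2 * (n + 1) - 1 = 2 * n + 1 by omega, spineLabel_even_succ]
    omega
  · intro k hk q hq hM q' hq'
    obtain ⟨h1, z, h2, h3, h4⟩ := hlab k q hM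
    have h5 := edgePos_leaf (a := a) (b := b) (c := c) hl (show 2 * k₀ < 2 * t by omega) hq'
      (by omega) (by omega)
    have h6 : t * (l + 1) = 2 * k₀ * (l + 1) + (l + 1) := by rw [h1]; ring
    have h7 := hwle (edgePos t l a b c (2 * k₀) q') (t * (l + 1) - 2) (by omega)
    rw [h4, leafLabel_even]
    omega
  · rintro k hk q hq k' hk' q' hq' hM hM' h
    have h0 := (hlab k q hM).1
    rcases hM with ⟨h1, h2, h3⟩ | ⟨h1, rfl, rfl⟩ <;>
      rcases hM' with ⟨h1', h2', h3'⟩ | ⟨h1', rfl, rfl⟩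
    · omega
    · rw [leafLabel_moved_lower hl h1 h0 h2 h3, leafLabel_moved_upper hl h1' h0 (by omega)] at h
      exact absurd (add_left_cancel h) (hab h1 h1')
    · rw [leafLabel_moved_lower hl h1' h0 h2' h3', leafLabel_moved_upper hl h1 h0 (by omega)] at h
      exact absurd (add_left_cancel h).symm (hab h1' h1)
    · exact ⟨rfl, rfl⟩

/-! ### Closing the cycle -/

theorem spineLabel_eq_sum (w : ℕ → ℤ) (Q : ℕ → ℕ → ℕ) (l n : ℕ) :
    spineLabel w Q l n = ∑ j ∈ Finset.range n, (-1) ^ j * w (Q j l) := by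
  induction n with
  | zero => rfl
  | succ n ih => rw [spineLabel, ih, Finset.sum_range_succ]

/-- Reflect $j\mapsto 2t-2-j$: signs agree and positions add to $2T-1$, so each pair contributes
$\pm M$. The exception is the fixed term $j=t-1$, at position $T$, which gives
$2w_T=M+(w_T-w_{T-1})$. -/
theorem two_mul_alternating_sum {M : ℤ} (ht : 1 ≤ t)
    (hM : ∀ i j, i + j + 1 = 2 * (t * (l + 1)) → w i + w j = M) :
    2 * ∑ j ∈ Finset.range (2 * t - 1),
        (-1) ^ j * w (if j + 1 < t then j * (l + 1) + l else j * (l + 1) + l + 1) =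
      M + (-1) ^ (t - 1) * (w (t * (l + 1)) - w (t * (l + 1) - 1)) := by
  set f : ℕ → ℤ := fun j =>
    (-1) ^ j * w (if j + 1 < t then j * (l + 1) + l else j * (l + 1) + l + 1) with hf
  have h1 : ∀ j ∈ Finset.range (2 * t - 1), f j + f (2 * t - 1 - 1 - j) =
      M * (-1) ^ j + if j = t - 1 then
        (-1) ^ (t - 1) * (w (t * (l + 1)) - w (t * (l + 1) - 1)) else 0 := by
    intro j hj
    rw [Finset.mem_range] at hj
    obtain ⟨i, hi⟩ : ∃ i, i + j + 2 = 2 * t := ⟨2 * t - 2 - j, by omega⟩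
    have hsign : (-1 : ℤ) ^ i = (-1) ^ j := by
      rcases Nat.even_or_odd j with h | h
      · rw [h.neg_one_pow, Even.neg_one_pow]
        rw [Nat.even_iff] at h ⊢; omega
      · rw [h.neg_one_pow, Odd.neg_one_pow]
        rw [Nat.odd_iff] at h ⊢; omega
    have hmul : i * (l + 1) + j * (l + 1) + 2 * (l + 1) = 2 * (t * (l + 1)) := by
      rw [← add_mul, ← add_mul, hi, mul_assoc]
    rw [show 2 * t - 1 - 1 - j = i by omega]
    simp only [hf, hsign]
    rcases Nat.lt_trichotomy (j + 1) t with h | h | h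
    · rw [if_pos h, if_neg (by omega), if_neg (by omega), ← mul_add, hM _ _ (by omega)]
      ring
    · have hij : i = j := by omega
      subst hij
      have h2 : i * (l + 1) + l + 1 = t * (l + 1) := by rw [← h]; ring
      have h3 := hM (t * (l + 1)) (t * (l + 1) - 1) (by omega)
      rw [if_neg (by omega), if_pos (by omega), h2, show t - 1 = i by omega, ← h3]
      ring
    · rw [if_neg (by omega), if_pos (by omega), if_neg (by omega), ← mul_add, hM _ _ (by omega)]
      ring
  have h2 := Finset.sum_range_reflect f (2 * t - 1)
  rw [two_mul]
  nth_rewrite 2 [← h2]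
  rw [← Finset.sum_add_distrib, Finset.sum_congr rfl h1, Finset.sum_add_distrib,
    ← Finset.mul_sum, Finset.sum_ite_eq' , if_pos (Finset.mem_range.2 (by omega)),
    neg_one_geom_sum, if_neg (by rw [Nat.even_iff]; omega), mul_one]

theorem spineLabel_closing {M : ℤ} (hl : 1 ≤ l) (ht : 2 ≤ t) (hb3 : b = 1 → 3 ≤ t)
    (hodd : a = 1 ∨ b = 1 → Odd t)
    (hM : ∀ i j, i + j + 1 = 2 * (t * (l + 1)) → w i + w j = M)
    (hgap : Odd t → w (t * (l + 1) - 1) - w (t * (l + 1)) =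
      (if a = 1 then w (t * (l + 1) - 2 * (l + 1) - 2) - w (t * (l + 1) - 2 * (l + 1) - 1) else 0) +
      if b = 1 then w (t * (l + 1) + (l + 1)) - w (t * (l + 1) + (l + 1) + 1) else 0) :
    spineLabel w (edgePos t l a b c) l (2 * t - 1) =
      w (edgePos t l a b c (2 * t - 1) l) := by
  set A : ℤ := if a = 1 then
    w (t * (l + 1) - 2 * (l + 1) - 2) - w (t * (l + 1) - 2 * (l + 1) - 1) else 0 with hA
  set B : ℤ := if b = 1 then
    w (t * (l + 1) + (l + 1)) - w (t * (l + 1) + (l + 1) + 1) else 0 with hB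
  -- Relative to the unmodified shift only the terms $j=t-3$ and $j=t$ change; for $t$ odd their
  -- signs are $+$ and $-$, so both changes raise the sum.
  have h1 : ∀ j ∈ Finset.range (2 * t - 1), (-1) ^ j * w (edgePos t l a b c j l) =
      ((-1) ^ j * w (if j + 1 < t then j * (l + 1) + l else j * (l + 1) + l + 1) +
        if j + 3 = t then (-1) ^ j * A else 0) - if j = t then (-1) ^ j * B else 0 := by
    intro j hj
    rw [Finset.mem_range] at hj
    have h4 := block_cases j t (l + 1)
    rcases edgePos_spine (a := a) (b := b) (c := c) hl (show j + 1 < 2 * t by omega) with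
      ⟨h, h', e⟩ | ⟨h, h', e⟩ | ⟨h, h', e⟩ | ⟨h, h', e⟩
    · rw [e, if_pos (by omega), if_pos h', if_neg (by omega), hA, if_pos h,
        show j * (l + 1) + l - 1 = t * (l + 1) - 2 * (l + 1) - 2 by omega,
        show j * (l + 1) + l = t * (l + 1) - 2 * (l + 1) - 1 by omega]
      ring
    · rw [e, if_pos h', if_neg (c := j = t) (by omega)]
      by_cases h5 : j + 3 = t
      · rw [if_pos h5, hA, if_neg (fun ha => h ⟨ha, h5⟩)]
        ring
      · rw [if_neg h5]
        ring
    · rw [e, if_neg (by omega), if_neg (c := j + 3 = t) (by omega)]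
      by_cases h5 : j = t
      · rw [if_pos h5, hB, if_neg (fun hb => h' ⟨hb, h5⟩)]
        ring
      · rw [if_neg h5]
        ring
    · rw [e, if_neg (by omega), if_neg (c := j + 3 = t) (by omega), if_pos h', hB, if_pos h,
        show j * (l + 1) + l + 2 = t * (l + 1) + (l + 1) + 1 by omega,
        show j * (l + 1) + l + 1 = t * (l + 1) + (l + 1) by omega]
      ring
  have hT : 2 ≤ t * (l + 1) := Nat.mul_le_mul ht (show 1 ≤ l + 1 by omega)
  have h2 := two_mul_alternating_sum (l := l) (show 1 ≤ t by omega) hM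
  have h3 := hM (t * (l + 1)) (t * (l + 1) - 1) (by omega)
  have h4 : ∑ j ∈ Finset.range (2 * t - 1), (if j = t then (-1) ^ j * B else 0) =
      (-1) ^ t * B := by
    rw [Finset.sum_ite_eq', if_pos (Finset.mem_range.2 (by omega))]
  have h5 : ∑ j ∈ Finset.range (2 * t - 1), (if j + 3 = t then (-1) ^ j * A else 0) =
      -((-1) ^ t * A) := by
    rcases Nat.lt_or_ge t 3 with h | h
    · have : A = 0 := by
        rw [hA, if_neg]
        intro ha
        have := hodd (Or.inl ha)
        rw [Nat.odd_iff] at this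
        omega
      simp [this]
    · obtain ⟨n, rfl⟩ : ∃ n, t = n + 3 := ⟨t - 3, by omega⟩
      simp only [Nat.add_right_cancel_iff]
      rw [Finset.sum_ite_eq', if_pos (Finset.mem_range.2 (by omega))]
      ring
  rw [edgePos_closing hl ht hb3, spineLabel_eq_sum, Finset.sum_congr rfl h1,
    Finset.sum_sub_distrib, Finset.sum_add_distrib, h4, h5]
  rcases Nat.even_or_odd t with h | h
  · have hA0 : A = 0 := by
      rw [hA, if_neg]
      exact fun ha => Nat.not_odd_iff_even.2 h (hodd (Or.inl ha))
    have hB0 : B = 0 := by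
      rw [hB, if_neg]
      exact fun hb => Nat.not_odd_iff_even.2 h (hodd (Or.inr hb))
    rw [Odd.neg_one_pow (by rw [Nat.even_iff] at h; rw [Nat.odd_iff]; omega)] at h2
    rw [hA0, hB0]
    linarith
  · have h6 := hgap h
    rw [Even.neg_one_pow (by rw [Nat.odd_iff] at h; rw [Nat.even_iff]; omega)] at h2
    rw [h.neg_one_pow]
    linarith

end

/-! ### Gaps between differences and the choice of parameters -/

theorem admissibleDiff_sub_succ {d m : ℕ} (i : ℕ) :
    admissibleDiff d m i - admissibleDiff d m (i + 1) = 1 + if m ∣ i + 1 then 1 else 0 := by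
  unfold admissibleDiff
  rw [Nat.succ_div]
  split_ifs <;> push_cast <;> ring

theorem admissibleDiff_mul_sub {d m h x : ℕ} (hx : x < m * h) :
    admissibleDiff d m (m * h - (x + 1)) =
      admissibleDiff d m (m * h) + (x + 1) + (x / m : ℕ) + 1 := by
  have hm : 0 < m := Nat.pos_of_ne_zero (by rintro rfl; simp at hx)
  have h1 : x / m + 1 ≤ h := (Nat.div_lt_iff_lt_mul hm).2 (by rwa [mul_comm])
  unfold admissibleDiff
  rw [Nat.mul_sub_div _ _ _ hx, Nat.mul_div_cancel_left _ hm]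
  rw [Nat.cast_sub h1, Nat.cast_sub (show x + 1 ≤ m * h from hx)]
  push_cast
  ring

/-- For the second claim, $2tL=dm$ and $2(L+1)=m(2k-d)$ with $t$, $d$ and $2k-d$ odd would give $L$
and $L+1$ the same 2-adic valuation. -/
theorem not_dvd_of_odd {t L d m : ℕ} (ht : Odd t) (hd : Odd d) (hm : 0 < m)
    (he : 2 * (t * L) = d * m) : ¬ m ∣ t * L ∧ ¬ m ∣ t * L + (L + 1) := by
  constructor
  · rintro ⟨k, hk⟩
    have h1 : m * (2 * k) = m * d := by rw [mul_comm m d, ← he, hk]; ring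
    have h2 := Nat.eq_of_mul_eq_mul_left hm h1
    rw [Nat.odd_iff] at hd
    omega
  · rintro ⟨k, hk⟩
    have he' : (2 : ℤ) * (t * L) = d * m := by exact_mod_cast he
    have hk' : (t : ℤ) * L + (L + 1) = m * k := by exact_mod_cast hk
    have h1 : (2 : ℤ) * ((L + 1) * d) = 2 * (t * L * (2 * k - d)) := by
      have h2 : (2 : ℤ) * (L + 1) = m * (2 * k - d) := by linear_combination 2 * hk' - he'
      linear_combination (d : ℤ) * h2 - (2 * k - d : ℤ) * he'
    have h3 : ((L : ℤ) + 1) * d = t * L * (2 * k - d) := by linarith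
    have h4 : Even (((L : ℤ) + 1) * d) ↔ Even ((t : ℤ) * L * (2 * k - d)) := by rw [h3]
    have ht' : ¬ Even (t : ℤ) := by rw [Int.even_coe_nat, Nat.not_even_iff_odd]; exact ht
    have hd' : ¬ Even (d : ℤ) := by rw [Int.even_coe_nat, Nat.not_even_iff_odd]; exact hd
    simp only [Int.even_mul, Int.even_add, Int.even_sub, ht', hd', Int.even_coe_nat] at h4
    simp at h4
    rw [← Nat.not_even_iff_odd] at h4
    tauto

theorem div_add_div_succ {L m : ℕ} (hm : 0 < m) :
    (2 * L + 1) / m = L / m + (L + 1) / m + (if m ≤ L % m + (L + 1) % m then 1 else 0) := by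
  rw [show 2 * L + 1 = L + (L + 1) by ring, Nat.add_div hm]

/-- The parameters `a`, `b`, `c` of `edgePos` for which the labeling closes up to a labeling of the
cycle when `t` is odd. -/
theorem exists_edgePos_parameters {t L d m : ℕ} (ht : Odd t) (ht3 : 3 ≤ t) (hL : 2 ≤ L)
    (hm : 0 < m) (he : 2 * (t * L) = d * m) :
    ∃ a b c : ℕ, c ≤ 1 ∧
    (a = 1 →
      admissibleDiff d m (t * L) < admissibleDiff d m (t * L - L - 2) +
        admissibleDiff d m (t * L - L - 1) - admissibleDiff d m (t * L - 2 * L - 2) ∧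
      admissibleDiff d m (t * L - L - 2) + admissibleDiff d m (t * L - L - 1) -
        admissibleDiff d m (t * L - 2 * L - 2) < admissibleDiff d m (t * L - 2)) ∧
    (b = 1 →
      admissibleDiff d m (t * L) < admissibleDiff d m (t * L) +
        admissibleDiff d m (t * L + L - c) - admissibleDiff d m (t * L + L + 1) ∧
      admissibleDiff d m (t * L) + admissibleDiff d m (t * L + L - c) -
        admissibleDiff d m (t * L + L + 1) < admissibleDiff d m (t * L - 2)) ∧
    (a = 1 → b = 1 →
      admissibleDiff d m (t * L - L - 2) + admissibleDiff d m (t * L - L - 1) -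
        admissibleDiff d m (t * L - 2 * L - 2) ≠
      admissibleDiff d m (t * L) + admissibleDiff d m (t * L + L - c) -
        admissibleDiff d m (t * L + L + 1)) ∧
    admissibleDiff d m (t * L - 1) - admissibleDiff d m (t * L) =
      (if a = 1 then admissibleDiff d m (t * L - 2 * L - 2) -
        admissibleDiff d m (t * L - 2 * L - 1) else 0) +
      if b = 1 then admissibleDiff d m (t * L + L) - admissibleDiff d m (t * L + L + 1) else 0 := by
  have hT := Nat.mul_le_mul_right L ht3
  have hs0 := admissibleDiff_sub_succ (d := d) (m := m) (t * L - 1)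
  have hs1 := admissibleDiff_sub_succ (d := d) (m := m) (t * L - 2)
  have hs2 := admissibleDiff_sub_succ (d := d) (m := m) (t * L - 2 * L - 2)
  have hs3 := admissibleDiff_sub_succ (d := d) (m := m) (t * L + L)
  have hs4 := admissibleDiff_sub_succ (d := d) (m := m) (t * L + L - 1)
  rw [show t * L - 1 + 1 = t * L by omega] at hs0
  rw [show t * L - 2 + 1 = t * L - 1 by omega] at hs1
  rw [show t * L - 2 * L - 2 + 1 = t * L - (2 * L + 1) by omega] at hs2
  rw [show t * L + L - 1 + 1 = t * L + L by omega] at hs4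
  have hs1' : 1 ≤ admissibleDiff d m (t * L - 2) - admissibleDiff d m (t * L - 1) := by
    rw [hs1]; split_ifs <;> norm_num
  rcases Nat.even_or_odd d with hd | hd
  -- For $d$ even the deficit is 2.
  · obtain ⟨h, hh⟩ : m ∣ t * L := by
      obtain ⟨k, rfl⟩ := hd
      exact ⟨k, by linarith⟩
    have hdvd : m ∣ t * L := ⟨h, hh⟩
    have h1 := @admissibleDiff_mul_sub d m h (L + 1) (by omega)
    have h2 := @admissibleDiff_mul_sub d m h L (by omega)
    have h3 := @admissibleDiff_mul_sub d m h (2 * L + 1) (by omega)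
    rw [← hh, show t * L - (L + 1 + 1) = t * L - L - 2 by omega] at h1
    rw [← hh, show t * L - (L + 1) = t * L - L - 1 by omega] at h2
    rw [← hh, show t * L - (2 * L + 1 + 1) = t * L - 2 * L - 2 by omega] at h3
    have hdiv := div_add_div_succ (L := L) hm
    rw [if_pos hdvd] at hs0
    have hd2 : m ∣ t * L - (2 * L + 1) ↔ m ∣ 2 * L + 1 :=
      (Nat.dvd_sub_iff_right (by omega) hdvd)
    have hd3 : m ∣ t * L + L + 1 ↔ m ∣ L + 1 := by
      rw [add_assoc]; exact Nat.dvd_add_right hdvd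
    have hd4 : m ∣ t * L + L ↔ m ∣ L := Nat.dvd_add_right hdvd
    rw [show t * L - (2 * L + 1) = t * L - 2 * L - 1 by omega] at hs2 hd2
    -- The first moved leaf lands 1 or 2 above $w_T$, according to whether $L+(L+1)$ carries modulo
    -- $m$.
    have hlow : admissibleDiff d m (t * L - L - 2) + admissibleDiff d m (t * L - L - 1) -
        admissibleDiff d m (t * L - 2 * L - 2) = admissibleDiff d m (t * L) +
          (2 - if m ≤ L % m + (L + 1) % m then 1 else 0) := by
      rw [h1, h2, h3, hdiv]
      split_ifs <;> push_cast <;> ring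
    rw [hlow]
    -- If either move alone gains 2, it suffices; otherwise each gains 1 and both are made.
    by_cases hc1 : m ∣ L + 1
    · rw [if_pos (hd3.2 hc1)] at hs3
      exact ⟨0, 1, 0, by omega, by omega, fun _ => by rw [Nat.sub_zero]; omega, by omega,
        by simp; omega⟩
    rw [if_neg (fun h => hc1 (hd3.1 h))] at hs3
    by_cases hc2 : m ∣ 2 * L + 1
    · rw [if_pos (hd2.2 hc2)] at hs2
      exact ⟨1, 0, 0, by omega, fun _ => by split_ifs <;> omega, by omega, by omega,
        by simp; omega⟩
    rw [if_neg (fun h => hc2 (hd2.1 h))] at hs2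
    -- The two moved leaves take the offsets 1 and 2 above $w_T$. With a carry the first has offset
    -- 1, and `c = 1` pushes the second to 2; without one, `c = 0` leaves the second at 1.
    by_cases hc3 : m ≤ L % m + (L + 1) % m
    · have hc4 : ¬ m ∣ L := by
        intro hL
        rw [Nat.dvd_iff_mod_eq_zero] at hL
        have := Nat.mod_lt (L + 1) hm
        omega
      rw [if_neg (fun h => hc4 (hd4.1 h))] at hs4
      rw [if_pos hc3]
      exact ⟨1, 1, 1, by omega, fun _ => by omega, fun _ => by omega, fun _ _ => by omega,
        by simp; omega⟩
    · rw [if_neg hc3]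
      refine ⟨1, 1, 0, by omega, fun _ => by omega, ?_, ?_, by simp; omega⟩
      · intro _; rw [Nat.sub_zero]; omega
      · intro _ _; rw [Nat.sub_zero]; omega
  -- For $d$ odd the deficit is 1 and the upper move gains exactly 1.
  · obtain ⟨h1, h2⟩ := not_dvd_of_odd ht hd hm he
    rw [if_neg h1] at hs0
    rw [add_assoc, if_neg h2] at hs3
    rw [← add_assoc] at hs3
    exact ⟨0, 1, 0, by omega, by omega, fun _ => by rw [Nat.sub_zero]; omega, by omega,
      by simp; omega⟩

/-! ### Assembly -/

theorem mainTheorem3 (t l : ℕ) (ht : 2 ≤ t) (hl : 1 ≤ l) :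
    (hairyCycle t l).edgeSet.ncard = 2 * t * (l + 1) ∧
      ∀ d : ℕ, d ∣ 2 * t * (l + 1) →
        ∃ f : Fin (2 * t) ⊕ Fin (2 * t) × Fin l → ℕ,
          (hairyCycle t l).IsDivisibleAlphaLabeling d f := by
  refine ⟨hairyCycle_edgeSet_ncard ht, ?_⟩
  rintro d ⟨m, he⟩
  have he' : 2 * (t * (l + 1)) = d * m := by rw [← he, mul_assoc]
  have hpos : 0 < d * m := by rw [← he]; positivity
  have hd : 0 < d := Nat.pos_of_mul_pos_right hpos
  have hm : 0 < m := Nat.pos_of_mul_pos_left hpos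
  have finish : ∀ a b c k₀ : ℕ, (a = 1 ∨ b = 1 → t = 2 * k₀ + 1) → c ≤ 1 →
      IsZigzag (admissibleDiff d m) (edgePos t l a b c) t l k₀ (isMoved l a b k₀) →
      spineLabel (admissibleDiff d m) (edgePos t l a b c) l (2 * t - 1) =
        admissibleDiff d m (edgePos t l a b c (2 * t - 1) l) →
      ∃ f, (hairyCycle t l).IsDivisibleAlphaLabeling d f := by
    intro a b c k₀ hk₀ hc h hclose
    refine ⟨_, h.isDivisibleAlphaLabeling ht hd hm he ?_ ?_ hclose⟩
    · intro j hj r hr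
      rw [← he']
      exact edgePos_lt hl hc (fun hb => by omega) hj hr
    · intro i hi
      rw [← he'] at hi
      exact edgePos_surj hl hc (fun ha => by omega) (fun hb => by omega) hi
  have hanti : ∀ i j, i < j → admissibleDiff d m j < admissibleDiff d m i :=
    fun i j => admissibleDiff_lt
  have hpos' : ∀ i < 2 * (t * (l + 1)), 0 < admissibleDiff d m i :=
    fun i hi => admissibleDiff_pos hm (by rwa [← he'])
  have hsymm : ∀ i j, i + j + 1 = 2 * (t * (l + 1)) →
      admissibleDiff d m i + admissibleDiff d m j = d * (m + 1) :=
    fun i j h => admissibleDiff_add_symm hm (by rw [h, he'])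
  rcases Nat.even_or_odd t with h | ⟨k₀, h⟩
  -- For $t$ even no leaf is moved, and the value of `k₀` is immaterial.
  · refine finish 0 0 0 0 (by omega) (by omega) ?_ ?_
    · exact isZigzag_edgePos hl ht (by omega) (by omega) hanti hpos' (by omega) (by omega)
        (by omega)
    · exact spineLabel_closing hl ht (by omega) (by omega) hsymm
        (fun h' => absurd h (Nat.not_even_iff_odd.2 h'))
  · obtain ⟨a, b, c, hc, ha, hb, hne, hgap⟩ := exists_edgePos_parameters (t := t) ⟨k₀, h⟩
      (by omega) (show 2 ≤ l + 1 by omega) hm he'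
    refine finish a b c k₀ (fun _ => h) hc ?_ ?_
    · exact isZigzag_edgePos hl ht hc (fun _ => h) hanti hpos' ha hb hne
    · exact spineLabel_closing hl ht (fun _ => by omega) (fun _ => ⟨k₀, h⟩) hsymm
        (fun _ => hgap)
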